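/- **Conventions.** Let $\mathcal C$ be a small additive category, $\mathbb E:\mathcal C^{\mathrm{op}}\times\mathcal C\to \mathrm{Ab}$ a biadditive functor, and $\mathfrak s$ a map assigning to each $\delta\in\mathbb E(C,A)$ an equivalence class $\mathfrak s(\delta)=[A\xrightarrow{x}B\xrightarrow{y}C]$ of sequences (two sequences with middle terms $B,B'$ are equivalent if there is an isomorphism $B\cong B'$ compatible with the morphisms from $A$ and to $C$). Write $a_*\delta=\mathbb E(C,a)(\delta)$, $c^*\delta=\mathbb E(c,A)(\delta)$. If $\mathfrak s(\delta)=[A\xrightarrow{x}B\xrightarrow{y}C]$, then $\langle A\xrightarrow{x}B\xrightarrow{y}C,\delta\rangle$ is called an $\mathfrak s$-triangle, $x$ an $\mathfrak s$-inflation and $y$ an $\mathfrak s$-deflation. The triple $(\mathcal C,\mathbb E,\mathfrak s)$ is *weakly extriangulated* if the following conditions (C1)–(C3) and their duals hold. * (C1) For every $\mathfrak s$-triangle $\langle A\xrightarrow{x}B\xrightarrow{y}C,\delta\rangle$ and every object $X$, the sequence $\mathcal C(X,A)\to\mathcal C(X,B)\to\mathcal C(X,C)\xrightarrow{f\mapsto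 f^*\delta}\mathbb E(X,A)$ is exact. * (C2) $\mathfrak s(0)=[A\xrightarrow{\mathrm{id}}A\to0]$ for $0\in\mathbb E(0,A)$. * (C3) For all $\mathfrak s$-triangles $\langle A\xrightarrow{x}B\xrightarrow{y}C,\delta\rangle$ and $\langle A'\xrightarrow{x'}B'\xrightarrow{y'}C,a_*\delta\rangle$, where $a:A\to A'$, there is $b:B\to B'$ with $bx=x'a$ and $y'b=y$ such that $\langle A\xrightarrow{\left[\begin{smallmatrix}x\\a\end{smallmatrix}\right]}B\oplus A'\xrightarrow{[b\ -x']}B',\,y'^*\delta\rangle$ is an $\mathfrak s$-triangle. It is *extriangulated* if moreover $\mathfrak s$-inflations are closed under composition and $\mathfrak s$-deflations are closed under composition. An *exact functor* $(F,\phi):(\mathcal C,\mathbb E,\mathfrak s)\to(\mathcal D,\mathbb F,\mathfrak t)$ between weakly extriangulated categories is an additive functor $F$ with a natural transformation $\phi:\mathbb E\Rightarrow\mathbb F\circ(F^{\mathrm{op}}\times F)$ such that $\mathfrak t(\phi(\delta))=[FA\xrightarrow{Fx}FB\xrightarrow{Fy}FC]$ for each $\mathfrak s$-triangle $\langle A\xrightarrow{x}B\xrightarrow{y}C,\delta\rangle$;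 composition is $(F',\phi')\circ(F,\phi)=(F'F,(\phi'\circ(F^{\mathrm{op}}\times F))\cdot\phi)$. A *natural transformation of exact functors* $\eta:(F,\phi)\Rightarrow(G,\psi)$ is a natural transformation $\eta:F\Rightarrow G$ with $(\eta_A)_*\phi_{C,A}(\delta)=(\eta_C)^*\psi_{C,A}(\delta)$ for all $\delta\in\mathbb E(C,A)$. **Theorem.** Let $(\mathcal C,\mathbb E,\mathfrak s)$ be an extriangulated category with $\mathcal C$ small, and let $\mathscr S$ be a class of morphisms of $\mathcal C$ satisfying * (M0) $\mathscr S$ contains all isomorphisms and is closed under composition and under finite direct sums. Let $\mathcal N_{\mathscr S}$ be the full subcategory of the objects $N$ such that $N\to0$ and $0\to N$ belong to $\mathscr S$, let $p:\mathcal C\to\overline{\mathcal C}=\mathcal C/[\mathcal N_{\mathscr S}]$, $f\mapsto\overline f$, be the quotient by the ideal of morphisms factoring through an object of $\mathcal N_{\mathscr S}$, and let $\overline{\mathscr S}$ be the closure of $p(\mathscr S)$ under composition with isomorphisms of $\overline{\mathcal C}$. Let $Q:\mathcal C\to\widetilde{\mathcal C}=\mathcal C[\mathscr S^{-1}]$ be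 the localization of $\mathcal C$ at $\mathscr S$. Suppose that * (MR1) $\overline{\mathscr S}$ satisfies 2-out-of-3 with respect to composition in $\overline{\mathcal C}$; * (MR2) $\overline{\mathscr S}$ is a (two-sided) multiplicative system in $\overline{\mathcal C}$; * (MR3) for all $\mathfrak s$-triangles $\langle A\xrightarrow{x}B\xrightarrow{y}C,\delta\rangle$, $\langle A'\xrightarrow{x'}B'\xrightarrow{y'}C',\delta'\rangle$ and all $a\in\mathcal C(A,A')$, $c\in\mathcal C(C,C')$ with $a_*\delta=c^*\delta'$ and $\overline a,\overline c\in\overline{\mathscr S}$, there is $\mathbf b\in\overline{\mathscr S}(B,B')$ with $\mathbf b\,\overline x=\overline{x'}\,\overline a$ and $\overline c\,\overline y=\overline{y'}\,\mathbf b$. Then: 1. $\widetilde{\mathcal C}$ is an additive category, and there are $\widetilde{\mathbb E}$, $\widetilde{\mathfrak s}$ and $\mu$ such that $(\widetilde{\mathcal C},\widetilde{\mathbb E},\widetilde{\mathfrak s})$ is a weakly extriangulated category and $(Q,\mu):(\mathcal C,\mathbb E,\mathfrak s)\to(\widetilde{\mathcal C},\widetilde{\mathbb E},\widetilde{\mathfrak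 s})$ is an exact functor. 2. The exact functor $(Q,\mu)$ of 1 has the following universal property, for every weakly extriangulated category $(\mathcal D,\mathbb F,\mathfrak t)$. (i) For every exact functor $(F,\phi):(\mathcal C,\mathbb E,\mathfrak s)\to(\mathcal D,\mathbb F,\mathfrak t)$ such that $F(s)$ is an isomorphism for all $s\in\mathscr S$, there is a unique exact functor $(\widetilde F,\widetilde\phi):(\widetilde{\mathcal C},\widetilde{\mathbb E},\widetilde{\mathfrak s})\to(\mathcal D,\mathbb F,\mathfrak t)$ with $(F,\phi)=(\widetilde F,\widetilde\phi)\circ(Q,\mu)$. (ii) If $(F,\phi),(G,\psi)$ are two exact functors as in (i), then for every natural transformation $\eta:(F,\phi)\Rightarrow(G,\psi)$ of exact functors there is a unique natural transformation $\widetilde\eta:(\widetilde F,\widetilde\phi)\Rightarrow(\widetilde G,\widetilde\psi)$ of exact functors with $\eta=\widetilde\eta\circ(Q,\mu)$. 3. Suppose moreover that (MR4) holds: $\{\mathbf v\,\overline x\,\mathbf u\mid x\text{ an }\mathfrak s\text{-inflation},\ \mathbf u,\mathbf v\in\overline{\mathscr S}\}$ is closed under composition in $\overline{\mathcal C}$,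 and so is $\{\mathbf v\,\overline y\,\mathbf u\mid y\text{ an }\mathfrak s\text{-deflation},\ \mathbf u,\mathbf v\in\overline{\mathscr S}\}$. Then the weakly extriangulated category $(\widetilde{\mathcal C},\widetilde{\mathbb E},\widetilde{\mathfrak s})$ of 1 is extriangulated. -/

import Mathlib

open CategoryTheory CategoryTheory.Limits Opposite

universe w v u w' v' u' w'' v'' u''

attribute [local instance] CategoryTheory.Limits.hasBinaryBiproducts_of_finite_biproducts

namespace Extri

/-- A sequence `A ⟶ mid ⟶ Z` with fixed end terms (no condition on the composite). -/
structure TwoSeq {C : Type u} [Category.{v} C] (A Z : C) where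
  mid : C
  i : A ⟶ mid
  p : mid ⟶ Z

/-- Two sequences `A ⟶ B ⟶ Z` and `A ⟶ B' ⟶ Z` are equivalent if there is an isomorphism
`b : B ≅ B'` compatible with the morphisms from `A` and to `Z`. -/
def TwoSeq.Equivalent {C : Type u} [Category.{v} C] {A Z : C} (T T' : TwoSeq A Z) : Prop :=
  ∃ b : T.mid ≅ T'.mid, T.i ≫ b.hom = T'.i ∧ b.hom ≫ T'.p = T.p

instance twoSeqSetoid {C : Type u} [Category.{v} C] (A Z : C) : Setoid (TwoSeq A Z) where
  r := TwoSeq.Equivalent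
  iseqv :=
    { refl := fun T => ⟨Iso.refl _, by simp, by simp⟩
      symm := by
        rintro T T' ⟨b, h₁, h₂⟩
        exact ⟨b.symm, by simp [← h₁], by simp [← h₂]⟩
      trans := by
        rintro T T' T'' ⟨b, h₁, h₂⟩ ⟨b', h₁', h₂'⟩
        exact ⟨b ≪≫ b', by simp [← h₁', ← h₁], by simp [h₂', h₂]⟩ }

/-- The underlying data `(E, s)` of an extriangulated structure on a category `C`: a biadditive
functor `E : Cᵒᵖ × C ⥤ Ab` (in curried form), and a map `s` which assigns to every extension
`δ ∈ E(Z, A)` an equivalence class `[A ⟶ B ⟶ Z]` of sequences. -/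
structure ExtData (C : Type u) [Category.{v} C] [Preadditive C] where
  E : Cᵒᵖ ⥤ C ⥤ AddCommGrpCat.{w}
  additive_left : E.Additive
  additive_right : ∀ Z : Cᵒᵖ, (E.obj Z).Additive
  s : ∀ {Z A : C}, ((E.obj (op Z)).obj A) → Quotient (twoSeqSetoid A Z)

namespace ExtData

section

variable {C : Type u} [Category.{v} C] [Preadditive C] (X : ExtData.{w} C)

/-- The group `E(Z, A)` of extensions. -/
abbrev Ext (Z A : C) : Type w := (X.E.obj (op Z)).obj A

/-- `a_* δ = E(Z, a)(δ)`. -/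
def push {Z A A' : C} (a : A ⟶ A') (δ : X.Ext Z A) : X.Ext Z A' :=
  (X.E.obj (op Z)).map a δ

/-- `c^* δ = E(c, A)(δ)`. -/
def pull {Z Z' A : C} (c : Z' ⟶ Z) (δ : X.Ext Z A) : X.Ext Z' A :=
  (X.E.map c.op).app A δ

/-- `A --x--> B --y--> Z` together with `δ ∈ E(Z, A)` is an `s`-triangle:
`s(δ) = [A --x--> B --y--> Z]`. -/
def IsTriangle {A B Z : C} (x : A ⟶ B) (y : B ⟶ Z) (δ : X.Ext Z A) : Prop :=
  X.s δ = Quotient.mk (twoSeqSetoid A Z) ⟨B, x, y⟩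

/-- `x` is an `s`-inflation. -/
def IsInflation {A B : C} (x : A ⟶ B) : Prop :=
  ∃ (Z : C) (y : B ⟶ Z) (δ : X.Ext Z A), X.IsTriangle x y δ

/-- `y` is an `s`-deflation. -/
def IsDeflation {B Z : C} (y : B ⟶ Z) : Prop :=
  ∃ (A : C) (x : A ⟶ B) (δ : X.Ext Z A), X.IsTriangle x y δ

end

section

variable {C : Type u} [Category.{v} C] [Preadditive C] [HasFiniteBiproducts C]

/-- The triple `(C, E, s)`, where `C` is an additive category, is a weakly extriangulated
category. -/
structure IsWeaklyExtriangulated (X : ExtData.{w} C) : Prop where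
  /-- (C1): `C(W, A) → C(W, B) → C(W, Z) → E(W, A)` is exact. -/
  exact_covariant : ∀ {A B Z : C} (x : A ⟶ B) (y : B ⟶ Z) (δ : X.Ext Z A), X.IsTriangle x y δ →
    ∀ W : C,
      Function.Exact (fun g : W ⟶ A => g ≫ x) (fun g : W ⟶ B => g ≫ y) ∧
      Function.Exact (fun g : W ⟶ B => g ≫ y) (fun g : W ⟶ Z => X.pull g δ)
  /-- (C1'): `C(Z, W) → C(B, W) → C(A, W) → E(Z, W)` is exact. -/
  exact_contravariant : ∀ {A B Z : C} (x : A ⟶ B) (y : B ⟶ Z) (δ : X.Ext Z A),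
    X.IsTriangle x y δ → ∀ W : C,
      Function.Exact (fun g : Z ⟶ W => y ≫ g) (fun g : B ⟶ W => x ≫ g) ∧
      Function.Exact (fun g : B ⟶ W => x ≫ g) (fun g : A ⟶ W => X.push g δ)
  /-- (C2): `s(0) = [A = A ⟶ O]` for `0 ∈ E(O, A)`, `O` a zero object. -/
  triangle_id_zero : ∀ (A O : C), IsZero O → X.IsTriangle (𝟙 A) (0 : A ⟶ O) 0
  /-- (C2'): `s(0) = [O ⟶ A = A]` for `0 ∈ E(A, O)`, `O` a zero object. -/
  triangle_zero_id : ∀ (A O : C), IsZero O → X.IsTriangle (0 : O ⟶ A) (𝟙 A) 0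
  /-- (C3) -/
  cobase_change : ∀ {A B Z A' B' : C} (x : A ⟶ B) (y : B ⟶ Z) (δ : X.Ext Z A) (a : A ⟶ A')
    (x' : A' ⟶ B') (y' : B' ⟶ Z), X.IsTriangle x y δ → X.IsTriangle x' y' (X.push a δ) →
    ∃ b : B ⟶ B', x ≫ b = a ≫ x' ∧ b ≫ y' = y ∧
      X.IsTriangle (biprod.lift x a) (biprod.desc b (-x')) (X.pull y' δ)
  /-- (C3') -/
  base_change : ∀ {A B Z Z' B' : C} (x : A ⟶ B) (y : B ⟶ Z) (δ : X.Ext Z A) (c : Z' ⟶ Z)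
    (x' : A ⟶ B') (y' : B' ⟶ Z'), X.IsTriangle x y δ → X.IsTriangle x' y' (X.pull c δ) →
    ∃ b : B' ⟶ B, x' ≫ b = x ∧ b ≫ y = y' ≫ c ∧
      X.IsTriangle (biprod.lift (-y') b) (biprod.desc c y) (X.push x' δ)

/-- The triple `(C, E, s)` is an extriangulated category. -/
structure IsExtriangulated (X : ExtData.{w} C) : Prop extends X.IsWeaklyExtriangulated where
  /-- (C4) -/
  inflation_comp : ∀ {A B D : C} (f : A ⟶ B) (g : B ⟶ D),
    X.IsInflation f → X.IsInflation g → X.IsInflation (f ≫ g)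
  /-- (C4') -/
  deflation_comp : ∀ {A B D : C} (f : A ⟶ B) (g : B ⟶ D),
    X.IsDeflation f → X.IsDeflation g → X.IsDeflation (f ≫ g)

end

end ExtData

/-- An exact functor `(F, φ) : (C, E, s) ⟶ (D, E', s')`: an additive functor `F`, a natural
transformation `φ : E ⟹ E' ∘ (Fᵒᵖ × F)` of functors to abelian groups (given by its components,
so that the values of `E` and `E'` may live in different universes), such that `(F, φ)` sends
`s`-triangles to `s'`-triangles. -/
structure ExtExactFunctor {C : Type u} [Category.{v} C] [Preadditive C]
    {D : Type u'} [Category.{v'} D] [Preadditive D]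
    (X : ExtData.{w} C) (Y : ExtData.{w'} D) where
  F : C ⥤ D
  additive : F.Additive
  φ : ∀ Z A : C, X.Ext Z A →+ Y.Ext (F.obj Z) (F.obj A)
  φ_push : ∀ {Z A A' : C} (a : A ⟶ A') (δ : X.Ext Z A),
    φ Z A' (X.push a δ) = Y.push (F.map a) (φ Z A δ)
  φ_pull : ∀ {Z Z' A : C} (c : Z' ⟶ Z) (δ : X.Ext Z A),
    φ Z' A (X.pull c δ) = Y.pull (F.map c) (φ Z A δ)
  map_triangle : ∀ {A B Z : C} (x : A ⟶ B) (y : B ⟶ Z) (δ : X.Ext Z A),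
    X.IsTriangle x y δ → Y.IsTriangle (F.map x) (F.map y) (φ Z A δ)

/-- Composition of exact functors: `(F', φ') ∘ (F, φ) = (F' ∘ F, (φ' ∘ (Fᵒᵖ × F)) · φ)`. -/
def ExtExactFunctor.comp {C : Type u} [Category.{v} C] [Preadditive C]
    {D : Type u'} [Category.{v'} D] [Preadditive D]
    {D' : Type u''} [Category.{v''} D'] [Preadditive D']
    {X : ExtData.{w} C} {Y : ExtData.{w'} D} {Y' : ExtData.{w''} D'}
    (L : ExtExactFunctor X Y) (M : ExtExactFunctor Y Y') : ExtExactFunctor X Y' where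
  F := L.F ⋙ M.F
  additive := by
    have := L.additive
    have := M.additive
    infer_instance
  φ Z A := (M.φ (L.F.obj Z) (L.F.obj A)).comp (L.φ Z A)
  φ_push a δ := (congrArg (M.φ _ _) (L.φ_push a δ)).trans (M.φ_push _ _)
  φ_pull c δ := (congrArg (M.φ _ _) (L.φ_pull c δ)).trans (M.φ_pull _ _)
  map_triangle x y δ h := M.map_triangle _ _ _ (L.map_triangle x y δ h)

/-- A natural transformation `(F, φ) ⟹ (G, ψ)` of exact functors. -/
structure ExtNatTrans {C : Type u} [Category.{v} C] [Preadditive C]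
    {D : Type u'} [Category.{v'} D] [Preadditive D]
    {X : ExtData.{w} C} {Y : ExtData.{w'} D} (L M : ExtExactFunctor X Y) where
  η : L.F ⟶ M.F
  comm : ∀ {Z A : C} (δ : X.Ext Z A),
    Y.push (η.app A) (L.φ Z A δ) = Y.pull (η.app Z) (M.φ Z A δ)

/-- The horizontal composite of a natural transformation of exact functors `η : M ⟹ M'` with an
exact functor `L`, a natural transformation `M ∘ L ⟹ M' ∘ L`. -/
def ExtNatTrans.whiskerLeft {C : Type u} [Category.{v} C] [Preadditive C]
    {D : Type u'} [Category.{v'} D] [Preadditive D]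
    {D' : Type u''} [Category.{v''} D'] [Preadditive D']
    {X : ExtData.{w} C} {Y : ExtData.{w'} D} {Y' : ExtData.{w''} D'}
    (L : ExtExactFunctor X Y) {M M' : ExtExactFunctor Y Y'} (η : ExtNatTrans M M') :
    ExtNatTrans (L.comp M) (L.comp M') where
  η := Functor.whiskerLeft L.F η.η
  comm δ := η.comm (L.φ _ _ δ)

section Localization

variable {C : Type u} [Category.{v} C] [Preadditive C] [HasFiniteBiproducts C]

/-- Condition (M0): the class `S` contains all isomorphisms, and is closed under composition and
under finite direct sums. -/
structure M0 (S : MorphismProperty C) : Prop where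
  of_isIso : ∀ {A B : C} (f : A ⟶ B), IsIso f → S f
  comp : ∀ {A B D : C} (f : A ⟶ B) (g : B ⟶ D), S f → S g → S (f ≫ g)
  biprod_map : ∀ {A₁ A₂ B₁ B₂ : C} (f₁ : A₁ ⟶ B₁) (f₂ : A₂ ⟶ B₂),
    S f₁ → S f₂ → S (biprod.map f₁ f₂)

/-- The objects `N` such that `N ⟶ 0` and `0 ⟶ N` both belong to `S`. -/
def NS (S : MorphismProperty C) (N : C) : Prop :=
  ∃ O : C, IsZero O ∧ S (0 : N ⟶ O) ∧ S (0 : O ⟶ N)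

/-- Two parallel morphisms are identified modulo the ideal `[N_S]` if their difference factors
through an object of `N_S`. -/
def idealRel (S : MorphismProperty C) : HomRel C := fun A B f g =>
  ∃ (N : C) (i : A ⟶ N) (j : N ⟶ B), NS S N ∧ g = f + i ≫ j

/-- The ideal quotient `C / [N_S]`. -/
abbrev IdealQuotient (S : MorphismProperty C) := CategoryTheory.Quotient (idealRel S)

/-- The quotient functor `p : C ⥤ C / [N_S]`. -/
abbrev quotFunctor (S : MorphismProperty C) : C ⥤ IdealQuotient S :=
  CategoryTheory.Quotient.functor (idealRel S)

/-- The class `S̄` of all composites `β ∘ p(s) ∘ γ` with `s ∈ S` and `β`, `γ` isomorphisms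
of `C / [N_S]`. -/
abbrev Sbar (S : MorphismProperty C) : MorphismProperty (IdealQuotient S) :=
  S.map (quotFunctor S)

/-- Condition (MR1): two-out-of-three. -/
def MR1 (S : MorphismProperty C) : Prop := (Sbar S).HasTwoOutOfThreeProperty

/-- Condition (MR2): `S̄` is a (two-sided) multiplicative system. -/
def MR2 (S : MorphismProperty C) : Prop :=
  (Sbar S).HasLeftCalculusOfFractions ∧ (Sbar S).HasRightCalculusOfFractions

/-- Condition (MR3): completion of morphisms of `s`-triangles in `C / [N_S]`. -/
def MR3 (X : ExtData.{w} C) (S : MorphismProperty C) : Prop :=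
  ∀ {A B Z A' B' Z' : C} (x : A ⟶ B) (y : B ⟶ Z) (δ : X.Ext Z A)
    (x' : A' ⟶ B') (y' : B' ⟶ Z') (δ' : X.Ext Z' A') (a : A ⟶ A') (c : Z ⟶ Z'),
    X.IsTriangle x y δ → X.IsTriangle x' y' δ' → X.push a δ = X.pull c δ' →
    Sbar S ((quotFunctor S).map a) → Sbar S ((quotFunctor S).map c) →
    ∃ b : (quotFunctor S).obj B ⟶ (quotFunctor S).obj B', Sbar S b ∧
      (quotFunctor S).map x ≫ b = (quotFunctor S).map a ≫ (quotFunctor S).map x' ∧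
      b ≫ (quotFunctor S).map y' = (quotFunctor S).map y ≫ (quotFunctor S).map c

/-- The class of morphisms `v ∘ p(x) ∘ u` of `C / [N_S]` with `x` an `s`-inflation and
`u, v ∈ S̄`. -/
def Minf (X : ExtData.{w} C) (S : MorphismProperty C) : MorphismProperty (IdealQuotient S) :=
  fun P R f => ∃ (A B : C) (x : A ⟶ B) (u : P ⟶ (quotFunctor S).obj A)
    (v : (quotFunctor S).obj B ⟶ R), X.IsInflation x ∧ Sbar S u ∧ Sbar S v ∧
      f = u ≫ (quotFunctor S).map x ≫ v

/-- The class of morphisms `v ∘ p(y) ∘ u` of `C / [N_S]` with `y` an `s`-deflation and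
`u, v ∈ S̄`. -/
def Mdef (X : ExtData.{w} C) (S : MorphismProperty C) : MorphismProperty (IdealQuotient S) :=
  fun P R f => ∃ (A B : C) (y : A ⟶ B) (u : P ⟶ (quotFunctor S).obj A)
    (v : (quotFunctor S).obj B ⟶ R), X.IsDeflation y ∧ Sbar S u ∧ Sbar S v ∧
      f = u ≫ (quotFunctor S).map y ≫ v

/-- Condition (MR4). -/
def MR4 (X : ExtData.{w} C) (S : MorphismProperty C) : Prop :=
  (Minf X S).IsStableUnderComposition ∧ (Mdef X S).IsStableUnderComposition

/-- The exact functor `L : X ⟶ Y` is universal among the exact functors inverting `S` with values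
in weakly extriangulated categories (whose sizes are given by the universes `u'`, `v'`, `w'`).

Part (ii) is expressed for exact functors `F = F₁ ∘ L` and `G = G₁ ∘ L` where `F₁` and `G₁` are the
exact functors induced by `F` and `G`. -/
def IsUniversal {C' : Type u''} [Category.{v''} C'] [Preadditive C'] {X : ExtData.{w} C}
    {Y : ExtData.{w''} C'} (S : MorphismProperty C) (L : ExtExactFunctor X Y) : Prop :=
  ∀ (D : Type u') [Category.{v'} D] [Preadditive D] [HasFiniteBiproducts D] (T : ExtData.{w'} D),
    T.IsWeaklyExtriangulated →
    (∀ F : ExtExactFunctor X T, S.IsInvertedBy F.F → ∃! F₁ : ExtExactFunctor Y T, L.comp F₁ = F) ∧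
    (∀ (F₁ G₁ : ExtExactFunctor Y T), S.IsInvertedBy (L.comp F₁).F → S.IsInvertedBy (L.comp G₁).F →
      ∀ η : ExtNatTrans (L.comp F₁) (L.comp G₁),
        ∃! η₁ : ExtNatTrans F₁ G₁, ExtNatTrans.whiskerLeft L η₁ = η)

end Localization

end Extri

open Extri

/-!
The class `W` of all morphisms of `C` which become members of `S̄` in `C / [N_S]` has the same
localization as `S`: a functor inverting `S` identifies morphisms which agree modulo `[N_S]`
(`M0.map_eq_of_idealRel`), so that `C[S⁻¹]` is a localization of `C / [N_S]` at `S̄`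
(`M0.isLocalization`). By (MR2), `C[S⁻¹]` is therefore computed by fractions of both kinds; this
makes it additive, and `IsFractionLocalization` records what is needed of the fractions.

By (MR3), an inflation whose cokernel is null, or a deflation whose kernel is null, lies in `W`
(`inflation_mem`, `deflation_mem`). Consequently an extension pulled back from a null object is
annihilated by a denominator, and after dividing `E` by the extensions which are annihilated by
denominators one obtains a bifunctor on `C / [N_S]` (`extQuotient`). The localized bifunctor is its
left Kan extension along `(C / [N_S])ᵒᵖ × C / [N_S] ⥤ C[S⁻¹]ᵒᵖ × C[S⁻¹]`, whose pointwise colimits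
are filtered by the calculus of fractions. Hence each localized extension is the image of some
`δ` in `E` up to isomorphisms of the end terms, and an extension `δ` with zero image is killed by
`s_* t^*` for some `s`, `t` in `W` (`bifunctorLan_exists_rep`, `bifunctorLan_exists_eq_zero`). The
realization of a localized extension is the image of that of `δ` (`IsExtLocalization`).

The image of a triangle is exact (`isExactSeq_map`): an exactness problem in the localization is
cleared of denominators and solved in `C`, at the cost of replacing the triangle by a base change
which (MR3) or a null object shows to be isomorphic to it in the localization. By the five lemma
(`IsExactSeq.isIso_mid`) the realization is then independent of the choice of `δ`
(`isTriangle_of_iso_map`), so that (C1)-(C3) and their duals pass from `C` to `C[S⁻¹]`. The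
transformation required for the universal property is defined on `μ δ` by its value on `δ` and
transported by the isomorphisms of the end terms (`DescRel`, `exists_desc`). Finally, two
composable inflations of `C[S⁻¹]` have, after a cobase change, representatives in `C` which are
composable up to a member of `W` (`inflation_comp`), and (MR4) says that such a composite is again
the image of an inflation.
-/

namespace Extri

/-! ### Calculus of extensions -/

namespace ExtData

section

variable {C : Type u} [Category.{v} C] [Preadditive C] (X : ExtData.{w} C)

@[simp] lemma push_id {Z A : C} (δ : X.Ext Z A) : X.push (𝟙 A) δ = δ := by simp [push]

@[simp] lemma pull_id {Z A : C} (δ : X.Ext Z A) : X.pull (𝟙 Z) δ = δ := by simp [pull]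

lemma push_comp {Z A A' A'' : C} (a : A ⟶ A') (a' : A' ⟶ A'') (δ : X.Ext Z A) :
    X.push (a ≫ a') δ = X.push a' (X.push a δ) := by simp [push]

lemma pull_comp {Z Z' Z'' A : C} (c : Z' ⟶ Z) (c' : Z'' ⟶ Z') (δ : X.Ext Z A) :
    X.pull (c' ≫ c) δ = X.pull c' (X.pull c δ) := by simp [pull]

lemma push_pull {Z Z' A A' : C} (a : A ⟶ A') (c : Z' ⟶ Z) (δ : X.Ext Z A) :
    X.push a (X.pull c δ) = X.pull c (X.push a δ) :=
  (ConcreteCategory.congr_hom ((X.E.map c.op).naturality a) δ).symm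

@[simp] lemma push_zero {Z A A' : C} (a : A ⟶ A') : X.push a (0 : X.Ext Z A) = 0 :=
  map_zero ((X.E.obj (op Z)).map a).hom

@[simp] lemma pull_zero {Z Z' A : C} (c : Z' ⟶ Z) : X.pull c (0 : X.Ext Z A) = 0 :=
  map_zero ((X.E.map c.op).app A).hom

lemma push_add {Z A A' : C} (a : A ⟶ A') (δ δ' : X.Ext Z A) :
    X.push a (δ + δ') = X.push a δ + X.push a δ' :=
  map_add ((X.E.obj (op Z)).map a).hom δ δ'

lemma pull_add {Z Z' A : C} (c : Z' ⟶ Z) (δ δ' : X.Ext Z A) :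
    X.pull c (δ + δ') = X.pull c δ + X.pull c δ' :=
  map_add ((X.E.map c.op).app A).hom δ δ'

lemma push_neg {Z A A' : C} (a : A ⟶ A') (δ : X.Ext Z A) : X.push a (-δ) = -X.push a δ :=
  map_neg ((X.E.obj (op Z)).map a).hom δ

lemma pull_neg {Z Z' A : C} (c : Z' ⟶ Z) (δ : X.Ext Z A) : X.pull c (-δ) = -X.pull c δ :=
  map_neg ((X.E.map c.op).app A).hom δ

lemma add_push {Z A A' : C} (a a' : A ⟶ A') (δ : X.Ext Z A) :
    X.push (a + a') δ = X.push a δ + X.push a' δ := by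
  have := X.additive_right (op Z)
  simp [push, Functor.map_add]

lemma add_pull {Z Z' A : C} (c c' : Z' ⟶ Z) (δ : X.Ext Z A) :
    X.pull (c + c') δ = X.pull c δ + X.pull c' δ := by
  have := X.additive_left
  simp [pull, Functor.map_add, op_add]

lemma zero_push {Z A A' : C} (δ : X.Ext Z A) : X.push (0 : A ⟶ A') δ = 0 := by
  have := X.add_push (0 : A ⟶ A') 0 δ
  simpa using this

lemma zero_pull {Z Z' A : C} (δ : X.Ext Z A) : X.pull (0 : Z' ⟶ Z) δ = 0 := by
  have := X.add_pull (0 : Z' ⟶ Z) 0 δ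
  simpa using this

lemma push_injective {Z A A' : C} (a : A ⟶ A') [IsIso a] {δ δ' : X.Ext Z A}
    (h : X.push a δ = X.push a δ') : δ = δ' := by
  simpa [← push_comp] using congrArg (X.push (inv a)) h

lemma pull_injective {Z Z' A : C} (c : Z' ⟶ Z) [IsIso c] {δ δ' : X.Ext Z A}
    (h : X.pull c δ = X.pull c δ') : δ = δ' := by
  simpa [← pull_comp] using congrArg (X.pull (inv c)) h

/-- The four exactness properties that (C1) and its dual require of an `s`-triangle. -/
structure IsExactSeq {A B Z : C} (x : A ⟶ B) (y : B ⟶ Z) (δ : X.Ext Z A) : Prop where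
  comp_eq_zero : x ≫ y = 0
  pull_eq_zero : X.pull y δ = 0
  push_eq_zero : X.push x δ = 0
  lift_inflation : ∀ {W : C} (g : W ⟶ B), g ≫ y = 0 → ∃ h : W ⟶ A, h ≫ x = g
  lift_deflation : ∀ {W : C} (g : W ⟶ Z), X.pull g δ = 0 → ∃ h : W ⟶ B, h ≫ y = g
  desc_deflation : ∀ {W : C} (g : B ⟶ W), x ≫ g = 0 → ∃ h : Z ⟶ W, y ≫ h = g
  desc_inflation : ∀ {W : C} (g : A ⟶ W), X.push g δ = 0 → ∃ h : B ⟶ W, x ≫ h = g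

variable {X} in
lemma IsExactSeq.exact_covariant {A B Z : C} {x : A ⟶ B} {y : B ⟶ Z} {δ : X.Ext Z A}
    (h : X.IsExactSeq x y δ) (W : C) :
    Function.Exact (fun g : W ⟶ A => g ≫ x) (fun g : W ⟶ B => g ≫ y) ∧
      Function.Exact (fun g : W ⟶ B => g ≫ y) (fun g : W ⟶ Z => X.pull g δ) := by
  refine ⟨fun g => ⟨fun hg => h.lift_inflation g hg, ?_⟩,
    fun g => ⟨fun hg => h.lift_deflation g hg, ?_⟩⟩
  · rintro ⟨k, rfl⟩
    simp [h.comp_eq_zero]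
  · rintro ⟨k, rfl⟩
    simp [pull_comp, h.pull_eq_zero]

variable {X} in
lemma IsExactSeq.exact_contravariant {A B Z : C} {x : A ⟶ B} {y : B ⟶ Z} {δ : X.Ext Z A}
    (h : X.IsExactSeq x y δ) (W : C) :
    Function.Exact (fun g : Z ⟶ W => y ≫ g) (fun g : B ⟶ W => x ≫ g) ∧
      Function.Exact (fun g : B ⟶ W => x ≫ g) (fun g : A ⟶ W => X.push g δ) := by
  refine ⟨fun g => ⟨fun hg => h.desc_deflation g hg, ?_⟩,
    fun g => ⟨fun hg => h.desc_inflation g hg, ?_⟩⟩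
  · rintro ⟨k, rfl⟩
    simp [reassoc_of% h.comp_eq_zero]
  · rintro ⟨k, rfl⟩
    simp [push_comp, h.push_eq_zero]

variable {X} in
/-- Exactness is invariant under isomorphisms of sequences which match the extensions. -/
lemma IsExactSeq.of_iso {A B Z A' B' Z' : C} {x : A ⟶ B} {y : B ⟶ Z} {δ : X.Ext Z A}
    {x' : A' ⟶ B'} {y' : B' ⟶ Z'} {δ' : X.Ext Z' A'} (h : X.IsExactSeq x y δ)
    (α : A ≅ A') (β : B ≅ B') (γ : Z ≅ Z') (hx : x ≫ β.hom = α.hom ≫ x')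
    (hy : y ≫ γ.hom = β.hom ≫ y') (hδ : X.push α.hom δ = X.pull γ.hom δ') :
    X.IsExactSeq x' y' δ' := by
  obtain rfl : x' = α.inv ≫ x ≫ β.hom := by simp [hx]
  obtain rfl : y' = β.inv ≫ y ≫ γ.hom := by simp [hy]
  obtain rfl : δ' = X.pull γ.inv (X.push α.hom δ) := by simp [hδ, ← pull_comp]
  refine ⟨by simp [reassoc_of% h.comp_eq_zero], ?_, ?_, fun {W} g hg => ?_, fun {W} g hg => ?_,
    fun {W} g hg => ?_, fun {W} g hg => ?_⟩
  · rw [← pull_comp, ← push_pull]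
    simp [pull_comp, h.pull_eq_zero]
  · rw [push_pull, ← push_comp]
    simp [push_comp, h.push_eq_zero]
  · obtain ⟨k, hk⟩ := h.lift_inflation (g ≫ β.inv) (by
      rw [← cancel_mono γ.hom]
      simpa using hg)
    exact ⟨k ≫ α.hom, by simp [reassoc_of% hk]⟩
  · obtain ⟨k, hk⟩ := h.lift_deflation (g ≫ γ.inv) (by
      rw [← pull_comp, ← push_pull] at hg
      exact X.push_injective α.hom (by simpa using hg))
    exact ⟨k ≫ β.hom, by simp [reassoc_of% hk]⟩
  · obtain ⟨k, hk⟩ := h.desc_deflation (β.hom ≫ g) (by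
      rw [← cancel_epi α.inv]
      simpa using hg)
    exact ⟨γ.inv ≫ k, by simp [hk]⟩
  · obtain ⟨k, hk⟩ := h.desc_inflation (α.hom ≫ g) (by
      rw [push_pull, ← push_comp] at hg
      exact X.pull_injective γ.inv (by simpa using hg))
    exact ⟨β.inv ≫ k, by simp [hk]⟩

variable {X} in
/-- The five lemma: a morphism of exact sequences which is invertible at both ends and compatible
with the extensions is invertible in the middle. -/
lemma IsExactSeq.isIso_mid {A B Z A' B' Z' : C} {x : A ⟶ B} {y : B ⟶ Z} {δ : X.Ext Z A}
    {x' : A' ⟶ B'} {y' : B' ⟶ Z'} {δ' : X.Ext Z' A'} (h : X.IsExactSeq x y δ)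
    (h' : X.IsExactSeq x' y' δ') {a : A ⟶ A'} {b : B ⟶ B'} {c : Z ⟶ Z'} [IsIso a] [IsIso c]
    (hx : x ≫ b = a ≫ x') (hy : b ≫ y' = y ≫ c) (hδ : X.push a δ = X.pull c δ') :
    IsIso b := by
  have right : ∃ r : B' ⟶ B, r ≫ b = 𝟙 B' := by
    obtain ⟨g, hg⟩ := h.lift_deflation (y' ≫ inv c) (X.push_injective a (by
      rw [push_pull, hδ, ← pull_comp]
      simp [h'.pull_eq_zero]))
    obtain ⟨k, hk⟩ := h'.lift_inflation (𝟙 B' - g ≫ b) (by simp [hy, reassoc_of% hg])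
    exact ⟨g + k ≫ inv a ≫ x, by simp [hx, hk]⟩
  have left : ∃ l : B' ⟶ B, b ≫ l = 𝟙 B := by
    obtain ⟨g, hg⟩ := h'.desc_inflation (inv a ≫ x) (X.pull_injective c (by
      rw [push_comp, ← push_pull, ← push_pull, ← hδ, ← push_comp (X := X) a]
      simp [h.push_eq_zero]))
    obtain ⟨k, hk⟩ := h.desc_deflation (𝟙 B - b ≫ g) (by simp [reassoc_of% hx, hg])
    refine ⟨g + y' ≫ inv c ≫ k, ?_⟩
    simp [reassoc_of% hy, hk]
  obtain ⟨r, hr⟩ := right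
  obtain ⟨l, hl⟩ := left
  refine ⟨r, ?_, hr⟩
  have : l = r := by
    calc l = (r ≫ b) ≫ l := by simp [hr]
      _ = r := by simp [hl]
  rw [← this, hl]

variable {X} in
lemma IsTriangle.exists_iso {A B B' Z : C} {x : A ⟶ B} {y : B ⟶ Z} {x' : A ⟶ B'} {y' : B' ⟶ Z}
    {δ : X.Ext Z A} (h : X.IsTriangle x y δ) (h' : X.IsTriangle x' y' δ) :
    ∃ b : B ≅ B', x ≫ b.hom = x' ∧ b.hom ≫ y' = y :=
  Quotient.exact (h.symm.trans h')

variable {X} in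
lemma IsTriangle.of_iso_mid {A B B' Z : C} {x : A ⟶ B} {y : B ⟶ Z} {x' : A ⟶ B'} {y' : B' ⟶ Z}
    {δ : X.Ext Z A} (h : X.IsTriangle x y δ) (b : B ≅ B') (hx : x ≫ b.hom = x')
    (hy : b.hom ≫ y' = y) : X.IsTriangle x' y' δ :=
  Eq.trans h (Quotient.sound ⟨b, hx, hy⟩)

lemma exists_isTriangle {Z A : C} (δ : X.Ext Z A) :
    ∃ (B : C) (x : A ⟶ B) (y : B ⟶ Z), X.IsTriangle x y δ := by
  obtain ⟨T, hT⟩ := Quotient.exists_rep (X.s δ)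
  exact ⟨T.mid, T.i, T.p, hT.symm⟩

end

/-! ### Morphisms of triangles in a weakly extriangulated category -/

section

variable {C : Type u} [Category.{v} C] [Preadditive C] [HasFiniteBiproducts C] {X : ExtData.{w} C}

lemma IsWeaklyExtriangulated.isExactSeq (hX : X.IsWeaklyExtriangulated) {A B Z : C} {x : A ⟶ B}
    {y : B ⟶ Z} {δ : X.Ext Z A} (h : X.IsTriangle x y δ) : X.IsExactSeq x y δ where
  comp_eq_zero := ((hX.exact_covariant x y δ h A).1 x).2 ⟨𝟙 A, by simp⟩
  pull_eq_zero := ((hX.exact_covariant x y δ h B).2 y).2 ⟨𝟙 B, by simp⟩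
  push_eq_zero := ((hX.exact_contravariant x y δ h B).2 x).2 ⟨𝟙 B, by simp⟩
  lift_inflation g hg := ((hX.exact_covariant x y δ h _).1 g).1 hg
  lift_deflation g hg := ((hX.exact_covariant x y δ h _).2 g).1 hg
  desc_deflation g hg := ((hX.exact_contravariant x y δ h _).1 g).1 hg
  desc_inflation g hg := ((hX.exact_contravariant x y δ h _).2 g).1 hg

/-- A morphism of extensions `(a, c)` extends to a morphism of triangles: it factors through
`a_* δ = c^* δ'`, so (C3) and its dual each provide one half. -/
lemma IsWeaklyExtriangulated.exists_mid (hX : X.IsWeaklyExtriangulated) {A B Z A' B' Z' : C}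
    {x : A ⟶ B} {y : B ⟶ Z} {δ : X.Ext Z A} {x' : A' ⟶ B'} {y' : B' ⟶ Z'} {δ' : X.Ext Z' A'}
    (h : X.IsTriangle x y δ) (h' : X.IsTriangle x' y' δ') (a : A ⟶ A') (c : Z ⟶ Z')
    (hac : X.push a δ = X.pull c δ') : ∃ b : B ⟶ B', x ≫ b = a ≫ x' ∧ b ≫ y' = y ≫ c := by
  obtain ⟨M, i, p, hM⟩ := X.exists_isTriangle (X.push a δ)
  obtain ⟨b₁, h₁, h₁', -⟩ := hX.cobase_change x y δ a i p h hM
  obtain ⟨b₂, h₂, h₂', -⟩ := hX.base_change x' y' δ' c i p h' (hac ▸ hM)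
  exact ⟨b₁ ≫ b₂, by rw [reassoc_of% h₁, h₂], by rw [Category.assoc, h₂', reassoc_of% h₁']⟩

/-- Triangles are closed under isomorphisms. -/
lemma IsWeaklyExtriangulated.isTriangle_of_iso (hX : X.IsWeaklyExtriangulated)
    {A B Z A' B' Z' : C} {x : A ⟶ B} {y : B ⟶ Z} {δ : X.Ext Z A} {x' : A' ⟶ B'} {y' : B' ⟶ Z'}
    {δ' : X.Ext Z' A'} (h : X.IsTriangle x y δ) (α : A ≅ A') (β : B ≅ B') (γ : Z ≅ Z')
    (hx : x ≫ β.hom = α.hom ≫ x') (hy : y ≫ γ.hom = β.hom ≫ y')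
    (hδ : X.push α.hom δ = X.pull γ.hom δ') : X.IsTriangle x' y' δ' := by
  obtain ⟨M, i, p, hM⟩ := X.exists_isTriangle δ'
  obtain ⟨b, h₁, h₂⟩ := hX.exists_mid h hM α.hom γ.hom hδ
  have := (hX.isExactSeq h).isIso_mid (hX.isExactSeq hM) h₁ h₂ hδ
  exact hM.of_iso_mid ((asIso b).symm ≪≫ β)
    (by simp [← cancel_epi α.hom, ← hx, reassoc_of% (eq_comm.1 h₁)])
    (by simp [← hy, h₂])

end

end ExtData

/-! ### The ideal quotient and its localization -/

section

variable {C : Type u} [Category.{v} C] [Preadditive C] [HasFiniteBiproducts C]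
  {S : MorphismProperty C}

lemma M0.NS_of_isZero (h0 : M0 S) {O : C} (hO : IsZero O) : NS S O :=
  ⟨O, hO, h0.of_isIso _ ⟨0, hO.eq_of_src _ _, hO.eq_of_src _ _⟩,
    h0.of_isIso _ ⟨0, hO.eq_of_src _ _, hO.eq_of_src _ _⟩⟩

lemma M0.NS_biprod (h0 : M0 S) {N N' : C} (hN : NS S N) (hN' : NS S N') : NS S (N ⊞ N') := by
  obtain ⟨O, hO, h, h'⟩ := hN
  obtain ⟨O', hO', k, k'⟩ := hN'
  have hz : IsZero (O ⊞ O') := by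
    rw [IsZero.iff_id_eq_zero]
    ext <;> first | exact hO.eq_of_src _ _ | exact hO'.eq_of_src _ _
  refine ⟨O ⊞ O', hz, ?_, ?_⟩
  · rw [hz.eq_of_tgt 0 (biprod.map (0 : N ⟶ O) (0 : N' ⟶ O'))]
    exact h0.biprod_map _ _ h k
  · rw [hz.eq_of_src 0 (biprod.map (0 : O ⟶ N) (0 : O' ⟶ N'))]
    exact h0.biprod_map _ _ h' k'

lemma M0.congruence (h0 : M0 S) : Congruence (idealRel S) where
  equivalence :=
    { refl := fun f => by
        obtain ⟨O, hO⟩ := HasZeroObject.zero (C := C)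
        exact ⟨O, 0, 0, h0.NS_of_isZero hO, by simp⟩
      symm := by
        rintro f g ⟨N, i, j, hN, rfl⟩
        exact ⟨N, i, -j, hN, by simp⟩
      trans := by
        rintro f g h ⟨N, i, j, hN, rfl⟩ ⟨N', i', j', hN', rfl⟩
        exact ⟨N ⊞ N', biprod.lift i i', biprod.desc j j', h0.NS_biprod hN hN',
          by simp [biprod.lift_desc, add_assoc]⟩ }
  comp_left := by
    rintro A B D f g g' ⟨N, i, j, hN, rfl⟩
    exact ⟨N, f ≫ i, j, hN, by simp⟩
  comp_right := by
    rintro A B D f f' g ⟨N, i, j, hN, rfl⟩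
    exact ⟨N, i, j ≫ g, hN, by simp⟩

lemma M0.quotFunctor_map_eq_iff (h0 : M0 S) {A B : C} (f g : A ⟶ B) :
    (quotFunctor S).map f = (quotFunctor S).map g ↔ idealRel S f g :=
  have := h0.congruence
  CategoryTheory.Quotient.functor_map_eq_iff _ _ _

lemma M0.idealRel_add (h0 : M0 S) ⦃A B : C⦄ (f₁ f₂ g₁ g₂ : A ⟶ B) (hf : idealRel S f₁ f₂)
    (hg : idealRel S g₁ g₂) : idealRel S (f₁ + g₁) (f₂ + g₂) := by
  obtain ⟨N, i, j, hN, rfl⟩ := hf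
  obtain ⟨N', i', j', hN', rfl⟩ := hg
  exact ⟨N ⊞ N', biprod.lift i i', biprod.desc j j', h0.NS_biprod hN hN',
    by simp only [biprod.lift_desc]; abel⟩

/-- The class of morphisms of `C` which become members of `S̄` in the ideal quotient. -/
abbrev Slift (S : MorphismProperty C) : MorphismProperty C :=
  (Sbar S).inverseImage (quotFunctor S)

omit [HasFiniteBiproducts C] in
lemma Slift_of_mem {A B : C} {s : A ⟶ B} (hs : S s) : Slift S s :=
  S.map_mem_map _ s hs

/-- A functor which inverts `S` identifies morphisms which agree modulo `[N_S]`. Two such morphisms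
are the restrictions of one morphism `A ⊞ N ⟶ B` along two sections of `A ⊞ N ⟶ A`, which is in
`S`. -/
lemma M0.map_eq_of_idealRel (h0 : M0 S) {D : Type u'} [Category.{v'} D] (G : C ⥤ D)
    (hG : S.IsInvertedBy G) {A B : C} {f g : A ⟶ B} (h : idealRel S f g) :
    G.map f = G.map g := by
  obtain ⟨N, i, j, ⟨O, hO, hN, -⟩, rfl⟩ := h
  have hfst : S (biprod.fst : A ⊞ N ⟶ A) := by
    have : (biprod.fst : A ⊞ N ⟶ A) = biprod.map (𝟙 A) (0 : N ⟶ O) ≫ biprod.fst := by simp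
    rw [this]
    refine h0.comp _ _ (h0.biprod_map _ _ (h0.of_isIso _ inferInstance) hN)
      (h0.of_isIso _ ⟨biprod.inl, ?_, by simp⟩)
    ext
    · simp
    · exact hO.eq_of_tgt _ _
    · exact hO.eq_of_src _ _
    · exact hO.eq_of_src _ _
  have := hG _ hfst
  have e : G.map (biprod.lift (𝟙 A) 0) = G.map (biprod.lift (𝟙 A) i) := by
    rw [← cancel_mono (G.map (biprod.fst : A ⊞ N ⟶ A)), ← G.map_comp, ← G.map_comp]
    simp
  calc G.map f = G.map (biprod.lift (𝟙 A) 0 ≫ biprod.desc f j) := by simp [biprod.lift_desc]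
    _ = G.map (biprod.lift (𝟙 A) i ≫ biprod.desc f j) := by rw [G.map_comp, e, G.map_comp]
    _ = G.map (f + i ≫ j) := by simp [biprod.lift_desc]

/-- The functor `C / [N_S] ⥤ C[S⁻¹]` through which the localization functor factors. -/
noncomputable def M0.quotLocalization (h0 : M0 S) : IdealQuotient S ⥤ S.Localization :=
  CategoryTheory.Quotient.lift (idealRel S) S.Q
    (fun _ _ _ _ h => h0.map_eq_of_idealRel S.Q S.Q_inverts h)

lemma M0.quotLocalization_inverts (h0 : M0 S) : (Sbar S).IsInvertedBy h0.quotLocalization := by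
  rintro A B f ⟨A', B', s, hs, ⟨e⟩⟩
  have : IsIso (h0.quotLocalization.map ((quotFunctor S).map s)) := S.Q_inverts s hs
  exact ((MorphismProperty.isomorphisms _).arrow_mk_iso_iff
    (h0.quotLocalization.mapArrow.mapIso e)).1 this

/-- The strict universal property of the localization, transported from `C[S⁻¹]`. -/
noncomputable def M0.strictUniversalProperty (h0 : M0 S) (E : Type u') [Category.{v'} E] :
    Localization.StrictUniversalPropertyFixedTarget h0.quotLocalization (Sbar S) E where
  inverts := h0.quotLocalization_inverts
  lift F hF := Localization.Construction.lift (quotFunctor S ⋙ F)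
    (fun _ _ s hs => hF _ (S.map_mem_map _ s hs))
  fac F hF := CategoryTheory.Quotient.lift_unique' _ _ _
    (Localization.Construction.fac (quotFunctor S ⋙ F)
      (fun _ _ s hs => hF _ (S.map_mem_map _ s hs)))
  uniq F₁ F₂ h := Localization.Construction.uniq F₁ F₂
    (congrArg (fun G => quotFunctor S ⋙ G) h)

lemma M0.isLocalization (h0 : M0 S) : h0.quotLocalization.IsLocalization (Sbar S) :=
  Functor.IsLocalization.mk' _ _ (h0.strictUniversalProperty _) (h0.strictUniversalProperty _)

/-- `C[S⁻¹]` is preadditive, being the localization of `C / [N_S]` at a class with a calculus of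
fractions. -/
@[reducible]
noncomputable def locPreadditive (h0 : M0 S) (h2 : MR2 S) : Preadditive S.Localization :=
  letI := h0.congruence
  letI := CategoryTheory.Quotient.preadditive (idealRel S) h0.idealRel_add
  letI := h0.isLocalization
  letI := h2.1
  Localization.preadditive h0.quotLocalization (Sbar S)

lemma Q_additive (h0 : M0 S) (h2 : MR2 S) :
    letI := locPreadditive h0 h2
    S.Q.Additive := by
  let := h0.congruence
  let := CategoryTheory.Quotient.preadditive (idealRel S) h0.idealRel_add
  let := h0.isLocalization
  let := h2.1
  let := locPreadditive h0 h2
  have h₁ : (quotFunctor S).Additive := CategoryTheory.Quotient.functor_additive _ h0.idealRel_add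
  have h₂ : h0.quotLocalization.Additive :=
    Localization.functor_additive h0.quotLocalization (Sbar S)
  exact inferInstanceAs (quotFunctor S ⋙ h0.quotLocalization).Additive

end

section

variable {C : Type u} [Category.{v} C] [Preadditive C] {D : Type u'} [Category.{v'} D]
  [Preadditive D]

/-- An additive functor which is surjective on objects transports finite biproducts. -/
lemma hasFiniteBiproducts_of_surjective [HasFiniteBiproducts C] (Q : C ⥤ D) [Q.Additive]
    (hQ : Function.Surjective Q.obj) : HasFiniteBiproducts D := by
  have := preservesBinaryBiproducts_of_preservesBiproducts Q
  have : HasZeroObject D := Q.hasZeroObject_of_additive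
  have : HasBinaryBiproducts D := ⟨fun A B => by
    obtain ⟨A, rfl⟩ := hQ A
    obtain ⟨B, rfl⟩ := hQ B
    exact Functor.hasBinaryBiproduct_of_preserves Q A B⟩
  have : HasFiniteProducts D := hasFiniteProducts_of_has_binary_and_terminal
  exact HasFiniteBiproducts.of_hasFiniteProducts

/-- An additive functor `Q : C ⥤ D` which inverts `W`, such that every morphism of `D` is a left
and a right fraction with denominator in `W`, and such that a morphism `f` of `C` with `Q f = 0`
becomes zero modulo the objects satisfying `P`, after composition with a member of `W` on either
side. -/
structure IsFractionLocalization (Q : C ⥤ D) (W : MorphismProperty C) (P : C → Prop) : Prop where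
  isIso_map : ∀ {A B : C} {s : A ⟶ B}, W s → IsIso (Q.map s)
  id_mem : ∀ A : C, W (𝟙 A)
  comp_mem : ∀ {A B E : C} {s : A ⟶ B} {t : B ⟶ E}, W s → W t → W (s ≫ t)
  obj_surjective : Function.Surjective Q.obj
  exists_left : ∀ {A B : C} (f : Q.obj A ⟶ Q.obj B),
    ∃ (B' : C) (g : A ⟶ B') (s : B ⟶ B'), W s ∧ f ≫ Q.map s = Q.map g
  exists_right : ∀ {A B : C} (f : Q.obj A ⟶ Q.obj B),
    ∃ (A' : C) (g : A' ⟶ B) (t : A' ⟶ A), W t ∧ Q.map t ≫ f = Q.map g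
  left_null : ∀ {A B : C} {f : A ⟶ B}, Q.map f = 0 →
    ∃ (B' N : C) (s : B ⟶ B') (i : A ⟶ N) (j : N ⟶ B'), W s ∧ P N ∧ f ≫ s = i ≫ j
  right_null : ∀ {A B : C} {f : A ⟶ B}, Q.map f = 0 →
    ∃ (A' N : C) (t : A' ⟶ A) (i : A' ⟶ N) (j : N ⟶ B), W t ∧ P N ∧ t ≫ f = i ≫ j

end

section

variable {C : Type u} [Category.{v} C] [Preadditive C] [HasFiniteBiproducts C]
  {S : MorphismProperty C}

lemma isFractionLocalization_Q (h0 : M0 S) (h2 : MR2 S) :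
    letI := locPreadditive h0 h2
    IsFractionLocalization S.Q (Slift S) (NS S) := by
  let := h0.congruence
  let := h0.isLocalization
  let := h2.1
  let := h2.2
  let := locPreadditive h0 h2
  have hadd := Q_additive h0 h2
  have inv {A B : C} {s : A ⟶ B} (hs : Slift S s) : IsIso (S.Q.map s) :=
    h0.quotLocalization_inverts _ hs
  refine ⟨inv, fun A => MorphismProperty.id_mem (Sbar S) _, fun {A B E s t} hs ht => ?_,
    (Localization.Construction.objEquiv S).surjective, fun {A B} f => ?_, fun {A B} f => ?_,
    fun {A B} f hf => ?_, fun {A B} f hf => ?_⟩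
  · change Sbar S ((quotFunctor S).map (s ≫ t))
    rw [Functor.map_comp]
    exact MorphismProperty.comp_mem _ _ _ hs ht
  · obtain ⟨φ, hφ⟩ := Localization.exists_leftFraction h0.quotLocalization (Sbar S)
      (X := (quotFunctor S).obj A) (Y := (quotFunctor S).obj B) f
    obtain ⟨g, hg⟩ := (quotFunctor S).map_surjective (X := A) (Y := φ.Y'.as) φ.f
    obtain ⟨s, hs⟩ := (quotFunctor S).map_surjective (X := B) (Y := φ.Y'.as) φ.s
    refine ⟨_, g, s, ?_, ?_⟩
    · change Sbar S _
      rw [hs]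
      exact φ.hs
    · have := φ.map_comp_map_s h0.quotLocalization h0.quotLocalization_inverts
      rw [← hφ, ← hg, ← hs] at this
      exact this
  · obtain ⟨φ, hφ⟩ := Localization.exists_rightFraction h0.quotLocalization (Sbar S)
      (X := (quotFunctor S).obj A) (Y := (quotFunctor S).obj B) f
    obtain ⟨g, hg⟩ := (quotFunctor S).map_surjective (X := φ.X'.as) (Y := B) φ.f
    obtain ⟨s, hs⟩ := (quotFunctor S).map_surjective (X := φ.X'.as) (Y := A) φ.s
    refine ⟨_, g, s, ?_, ?_⟩
    · change Sbar S _
      rw [hs]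
      exact φ.hs
    · have := φ.map_s_comp_map h0.quotLocalization h0.quotLocalization_inverts
      rw [← hφ, ← hg, ← hs] at this
      exact this
  · have : h0.quotLocalization.map ((quotFunctor S).map f) =
        h0.quotLocalization.map ((quotFunctor S).map 0) :=
      hf.trans (S.Q.map_zero A B).symm
    rw [MorphismProperty.map_eq_iff_postcomp _ (Sbar S)] at this
    obtain ⟨B', s, hs, h⟩ := this
    obtain ⟨s, rfl⟩ := (quotFunctor S).map_surjective (X := B) (Y := B'.as) s
    replace h : (quotFunctor S).map (0 ≫ s) = (quotFunctor S).map (f ≫ s) := by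
      rw [Functor.map_comp, Functor.map_comp]
      exact h.symm
    rw [h0.quotFunctor_map_eq_iff] at h
    obtain ⟨N, i, j, hN, h⟩ := h
    exact ⟨_, N, s, i, j, hs, hN, by simpa using h⟩
  · have : h0.quotLocalization.map ((quotFunctor S).map f) =
        h0.quotLocalization.map ((quotFunctor S).map 0) :=
      hf.trans (S.Q.map_zero A B).symm
    rw [MorphismProperty.map_eq_iff_precomp _ (Sbar S)] at this
    obtain ⟨A', t, ht, h⟩ := this
    obtain ⟨t, rfl⟩ := (quotFunctor S).map_surjective (X := A'.as) (Y := A) t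
    replace h : (quotFunctor S).map (t ≫ 0) = (quotFunctor S).map (t ≫ f) := by
      rw [Functor.map_comp, Functor.map_comp]
      exact h.symm
    rw [h0.quotFunctor_map_eq_iff] at h
    obtain ⟨N, i, j, hN, h⟩ := h
    exact ⟨_, N, t, i, j, ht, hN, by simpa using h⟩

end

/-! ### Extensions annihilated by the denominators -/

section

variable {C : Type u} [Category.{v} C] [Preadditive C]

/-- The operation `δ ↦ a_* c^* δ` on extensions. -/
def ExtData.pushPull (X : ExtData.{w} C) {Z Z' A A' : C} (c : Z' ⟶ Z) (a : A ⟶ A') :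
    X.Ext Z A →+ X.Ext Z' A' where
  toFun δ := X.push a (X.pull c δ)
  map_zero' := by simp
  map_add' δ δ' := by rw [X.pull_add, X.push_add]

@[simp] lemma ExtData.pushPull_apply (X : ExtData.{w} C) {Z Z' A A' : C} (c : Z' ⟶ Z)
    (a : A ⟶ A') (δ : X.Ext Z A) : X.pushPull c a δ = X.push a (X.pull c δ) := rfl

lemma ExtData.pushPull_comp (X : ExtData.{w} C) {Z Z' Z'' A A' A'' : C} (c : Z' ⟶ Z)
    (c' : Z'' ⟶ Z') (a : A ⟶ A') (a' : A' ⟶ A'') (δ : X.Ext Z A) :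
    X.pushPull (c' ≫ c) (a ≫ a') δ = X.pushPull c' a' (X.pushPull c a δ) := by
  simp [X.push_comp, X.pull_comp, X.push_pull]

/-- The subgroup of the extensions `δ` such that every `a_* c^* δ` is annihilated by
`s_* t^*` for some `s, t` in `W`. Quantifying over `a` and `c` makes the stability under sums
and under the functoriality of `E` immediate. -/
def ExtData.vanishing (X : ExtData.{w} C) (W : MorphismProperty C) [W.IsMultiplicative] (Z A : C) :
    AddSubgroup (X.Ext Z A) where
  carrier := {δ | ∀ ⦃Z₁ A₁ : C⦄ (c : Z₁ ⟶ Z) (a : A ⟶ A₁), ∃ (Z₂ A₂ : C) (t : Z₂ ⟶ Z₁)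
    (s : A₁ ⟶ A₂), W t ∧ W s ∧ X.pushPull t s (X.pushPull c a δ) = 0}
  zero_mem' := fun Z₁ A₁ c a => ⟨Z₁, A₁, 𝟙 _, 𝟙 _, W.id_mem _, W.id_mem _, by simp⟩
  neg_mem' := by
    intro δ hδ Z₁ A₁ c a
    obtain ⟨Z₂, A₂, t, s, ht, hs, h⟩ := hδ c a
    exact ⟨Z₂, A₂, t, s, ht, hs, by rw [map_neg, map_neg, h, neg_zero]⟩
  add_mem' := by
    intro δ δ' hδ hδ' Z₁ A₁ c a
    obtain ⟨Z₂, A₂, t, s, ht, hs, h⟩ := hδ c a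
    obtain ⟨Z₃, A₃, t', s', ht', hs', h'⟩ := hδ' (t ≫ c) (a ≫ s)
    refine ⟨Z₃, A₃, t' ≫ t, s ≫ s', W.comp_mem _ _ ht' ht, W.comp_mem _ _ hs hs', ?_⟩
    rw [map_add, map_add, X.pushPull_comp, X.pushPull_comp, h, ← X.pushPull_comp c t a s, h',
      map_zero, add_zero]

lemma ExtData.pushPull_mem_vanishing (X : ExtData.{w} C) (W : MorphismProperty C)
    [W.IsMultiplicative] {Z Z' A A' : C} (c : Z' ⟶ Z) (a : A ⟶ A') {δ : X.Ext Z A}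
    (hδ : δ ∈ X.vanishing W Z A) : X.pushPull c a δ ∈ X.vanishing W Z' A' := by
  intro Z₁ A₁ c' a'
  obtain ⟨Z₂, A₂, t, s, ht, hs, h⟩ := hδ (c' ≫ c) (a ≫ a')
  exact ⟨Z₂, A₂, t, s, ht, hs, by rw [← X.pushPull_comp c, h]⟩

end

section

variable {C : Type u} [Category.{v} C] [Preadditive C] [HasFiniteBiproducts C]
  {X : ExtData.{w} C} {S : MorphismProperty C}

omit [HasFiniteBiproducts C] in
/-- Condition (MR3) in terms of morphisms of `C`. -/
lemma MR3.exists_mid (h3 : MR3 X S) {A B Z A' B' Z' : C} {x : A ⟶ B} {y : B ⟶ Z} {δ : X.Ext Z A}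
    {x' : A' ⟶ B'} {y' : B' ⟶ Z'} {δ' : X.Ext Z' A'} {a : A ⟶ A'} {c : Z ⟶ Z'}
    (h : X.IsTriangle x y δ) (h' : X.IsTriangle x' y' δ') (hac : X.push a δ = X.pull c δ')
    (ha : Slift S a) (hc : Slift S c) : ∃ b : B ⟶ B', Slift S b ∧
      (quotFunctor S).map (x ≫ b) = (quotFunctor S).map (a ≫ x') ∧
      (quotFunctor S).map (b ≫ y') = (quotFunctor S).map (y ≫ c) := by
  obtain ⟨b, hb, h₁, h₂⟩ := h3 x y δ x' y' δ' a c h h' hac ha hc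
  obtain ⟨b, rfl⟩ := (quotFunctor S).map_surjective b
  exact ⟨b, hb, by simpa using h₁, by simpa using h₂⟩

lemma M0.Slift_id (h0 : M0 S) (A : C) : Slift S (𝟙 A) :=
  Slift_of_mem (h0.of_isIso _ inferInstance)

/-- An inflation whose cokernel is null is in `S̄`: compare its triangle with that of `𝟙 A`. -/
lemma inflation_mem (hX : X.IsWeaklyExtriangulated) (h0 : M0 S) (h3 : MR3 X S) {A M N : C}
    {s : A ⟶ M} {q : M ⟶ N} {ε : X.Ext N A} (h : X.IsTriangle s q ε) (hN : NS S N) :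
    Slift S s := by
  obtain ⟨O, hO, -, hON⟩ := hN
  obtain ⟨b, hb, h₁, -⟩ := h3 _ _ _ _ _ _ (𝟙 A) (0 : O ⟶ N) (hX.triangle_id_zero A O hO) h
    (by simp [X.zero_pull]) (h0.Slift_id A) (Slift_of_mem hON)
  have e : b = (quotFunctor S).map s := by simpa using h₁
  change Sbar S _
  rw [← e]
  exact hb

/-- A deflation whose kernel is null is in `S̄`. -/
lemma deflation_mem (hX : X.IsWeaklyExtriangulated) (h0 : M0 S) (h3 : MR3 X S) {N M Z : C}
    {i : N ⟶ M} {t : M ⟶ Z} {ε : X.Ext Z N} (h : X.IsTriangle i t ε) (hN : NS S N) :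
    Slift S t := by
  obtain ⟨O, hO, hNO, -⟩ := hN
  obtain ⟨b, hb, -, h₂⟩ := h3 _ _ _ _ _ _ (0 : N ⟶ O) (𝟙 Z) h (hX.triangle_zero_id Z O hO)
    (by simp [X.zero_push]) (Slift_of_mem hNO) (h0.Slift_id Z)
  have e : b = (quotFunctor S).map t := by simpa using h₂
  change Sbar S _
  rw [← e]
  exact hb

/-- An extension of a null object is killed by its own inflation, which is a denominator. -/
lemma exists_push_eq_zero (hX : X.IsWeaklyExtriangulated) (h0 : M0 S) (h3 : MR3 X S) {N A : C}
    (hN : NS S N) (ε : X.Ext N A) : ∃ (A' : C) (s : A ⟶ A'), Slift S s ∧ X.push s ε = 0 := by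
  obtain ⟨M, s, q, h⟩ := X.exists_isTriangle ε
  exact ⟨M, s, inflation_mem hX h0 h3 h hN, (hX.isExactSeq h).push_eq_zero⟩

lemma exists_pull_eq_zero (hX : X.IsWeaklyExtriangulated) (h0 : M0 S) (h3 : MR3 X S) {Z N : C}
    (hN : NS S N) (ε : X.Ext Z N) : ∃ (Z' : C) (t : Z' ⟶ Z), Slift S t ∧ X.pull t ε = 0 := by
  obtain ⟨M, i, t, h⟩ := X.exists_isTriangle ε
  exact ⟨M, t, deflation_mem hX h0 h3 h hN, (hX.isExactSeq h).pull_eq_zero⟩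

/-- The operations `a_* c^*` depend on the classes of `a` and `c` in the ideal quotient only, up to
vanishing extensions: the difference is a sum of two extensions, one of which is pulled back from a
null object and the other pushed out from a null object. -/
lemma pushPull_sub_mem_vanishing (hX : X.IsWeaklyExtriangulated) (h0 : M0 S) (h3 : MR3 X S)
    [(Slift S).IsMultiplicative] {Z Z' A A' : C} {c c' : Z' ⟶ Z} {a a' : A ⟶ A'}
    (hc : (quotFunctor S).map c = (quotFunctor S).map c')
    (ha : (quotFunctor S).map a = (quotFunctor S).map a') (δ : X.Ext Z A) :
    -X.pushPull c a δ + X.pushPull c' a' δ ∈ X.vanishing (Slift S) Z' A' := by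
  rw [h0.quotFunctor_map_eq_iff] at hc ha
  obtain ⟨N, i, j, hN, rfl⟩ := hc
  obtain ⟨M, k, l, hM, rfl⟩ := ha
  have e : -X.pushPull c a δ + X.pushPull (c + i ≫ j) (a + k ≫ l) δ =
      X.push a (X.pull i (X.pull j δ)) + X.push l (X.push k (X.pull (c + i ≫ j) δ)) := by
    simp only [ExtData.pushPull_apply, X.add_push, X.add_pull, X.push_add, X.pull_comp, X.push_comp]
    abel
  rw [e]
  refine add_mem (fun Z₁ A₁ c₁ a₁ => ?_) (fun Z₁ A₁ c₁ a₁ => ?_)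
  · obtain ⟨A₂, s, hs, h⟩ := exists_push_eq_zero hX h0 h3 hN (X.push a₁ (X.push a (X.pull j δ)))
    refine ⟨Z₁, A₂, 𝟙 _, s, h0.Slift_id _, hs, ?_⟩
    simp only [ExtData.pushPull_apply, X.pull_id]
    rw [X.push_pull, X.push_pull, X.push_pull, X.push_pull, X.push_pull, h]
    simp
  · obtain ⟨Z₂, t, ht, h⟩ := exists_pull_eq_zero hX h0 h3 hM
      (X.pull c₁ (X.push k (X.pull (c + i ≫ j) δ)))
    refine ⟨Z₂, A₁, t, 𝟙 _, ht, h0.Slift_id _, ?_⟩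
    simp only [ExtData.pushPull_apply, X.push_id]
    rw [← X.push_pull l, ← X.push_pull a₁, ← X.push_pull l, h]
    simp

variable (X S) in
/-- The bifunctor `E / vanishing` on the ideal quotient. A morphism of the ideal quotient acts
through an arbitrary representative. -/
noncomputable def extQuotient (hX : X.IsWeaklyExtriangulated) (h0 : M0 S) (h3 : MR3 X S)
    [(Slift S).IsMultiplicative] : (IdealQuotient S)ᵒᵖ × IdealQuotient S ⥤ AddCommGrpCat.{w} where
  obj P := AddCommGrpCat.of
    (X.Ext P.1.unop.as P.2.as ⧸ X.vanishing (Slift S) P.1.unop.as P.2.as)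
  map {P P'} φ := AddCommGrpCat.ofHom (QuotientAddGroup.map _ _
    (X.pushPull ((quotFunctor S).preimage (X := P'.1.unop.as) (Y := P.1.unop.as) φ.1.unop)
      ((quotFunctor S).preimage (X := P.2.as) (Y := P'.2.as) φ.2))
    (fun _ h => X.pushPull_mem_vanishing (Slift S) _ _ h))
  map_id P := by
    refine AddCommGrpCat.hom_ext (AddMonoidHom.ext fun δ => ?_)
    obtain ⟨δ, rfl⟩ := QuotientAddGroup.mk_surjective δ
    refine (QuotientAddGroup.eq.2 (pushPull_sub_mem_vanishing hX h0 h3 (c' := 𝟙 _) (a' := 𝟙 _)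
      ?_ ?_ δ)).trans ?_
    · simp
      rfl
    · simp
      rfl
    · simp
  map_comp {P P' P''} φ ψ := by
    refine AddCommGrpCat.hom_ext (AddMonoidHom.ext fun δ => ?_)
    obtain ⟨δ, rfl⟩ := QuotientAddGroup.mk_surjective δ
    refine (QuotientAddGroup.eq.2 (pushPull_sub_mem_vanishing hX h0 h3
      (c' := (quotFunctor S).preimage (X := P''.1.unop.as) (Y := P'.1.unop.as) ψ.1.unop ≫
        (quotFunctor S).preimage (X := P'.1.unop.as) (Y := P.1.unop.as) φ.1.unop)
      (a' := (quotFunctor S).preimage (X := P.2.as) (Y := P'.2.as) φ.2 ≫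
        (quotFunctor S).preimage (X := P'.2.as) (Y := P''.2.as) ψ.2) ?_ ?_ δ)).trans ?_
    · simp
    · simp
    · rw [X.pushPull_comp]
      rfl

lemma extQuotient_map_mk (hX : X.IsWeaklyExtriangulated) (h0 : M0 S) (h3 : MR3 X S)
    [(Slift S).IsMultiplicative] {Z Z' A A' : C} (c : Z' ⟶ Z) (a : A ⟶ A') (δ : X.Ext Z A) :
    (extQuotient X S hX h0 h3).map (X := (op ((quotFunctor S).obj Z), (quotFunctor S).obj A))
      (Y := (op ((quotFunctor S).obj Z'), (quotFunctor S).obj A'))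
      (((quotFunctor S).map c).op, (quotFunctor S).map a) (QuotientAddGroup.mk δ) =
      QuotientAddGroup.mk (X.pushPull c a δ) :=
  QuotientAddGroup.eq.2 (pushPull_sub_mem_vanishing hX h0 h3 (by simp) (by simp) δ)

end

section

variable {C : Type u} [Category.{v} C] {D : Type u'} [Category.{v'} D]

/-- A localization functor for a class with a left calculus of fractions is coflat: a morphism
`L B ⟶ L A` is a left fraction, and `s : A ⟶ A'` in `W` makes `L A'` a further object over
`L A`. -/
lemma representablyCoflat_of_hasLeftCalculusOfFractions (L : C ⥤ D) (W : MorphismProperty C)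
    [L.IsLocalization W] [W.HasLeftCalculusOfFractions] : RepresentablyCoflat L where
  filtered d := by
    have hL : W.IsInvertedBy L := Localization.inverts L W
    have := Localization.essSurj L W
    let A := L.objPreimage d
    let e : L.obj A ≅ d := L.objObjPreimageIso d
    have key (Y : CostructuredArrow L d) : ∃ (A₁ : C) (f : Y.left ⟶ A₁) (s : A ⟶ A₁), W s ∧
        Y.hom ≫ e.inv ≫ L.map s = L.map f := by
      obtain ⟨φ, hφ⟩ := Localization.exists_leftFraction L W (Y.hom ≫ e.inv)
      exact ⟨_, φ.f, φ.s, φ.hs, by rw [reassoc_of% hφ, φ.map_comp_map_s]⟩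
    have toFrac (Y : CostructuredArrow L d) {A₁ : C} (f : Y.left ⟶ A₁) (s : A ⟶ A₁)
        [IsIso (L.map s)] (h : Y.hom ≫ e.inv ≫ L.map s = L.map f) :
        L.map f ≫ inv (L.map s) ≫ e.hom = Y.hom := by simp [← h]
    refine { cocone_objs := fun Y Y' => ?_, cocone_maps := fun Y Y' f g => ?_, nonempty := ?_ }
    · obtain ⟨A₁, f, s, hs, h⟩ := key Y
      obtain ⟨A₂, f', s', hs', h'⟩ := key Y'
      obtain ⟨ψ, hψ⟩ := (MorphismProperty.RightFraction.mk s hs s').exists_leftFraction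
      dsimp at hψ
      have h₁ : Y.hom ≫ e.inv ≫ L.map (s' ≫ ψ.s) = L.map (f ≫ ψ.f) := by
        rw [hψ, L.map_comp, L.map_comp, reassoc_of% h]
      have h₂ : Y'.hom ≫ e.inv ≫ L.map (s' ≫ ψ.s) = L.map (f' ≫ ψ.s) := by
        rw [L.map_comp, L.map_comp, reassoc_of% h']
      have := hL _ (W.comp_mem _ _ hs' ψ.hs)
      refine ⟨CostructuredArrow.mk (Y := ψ.Y') (inv (L.map (s' ≫ ψ.s)) ≫ e.hom),
        CostructuredArrow.homMk (f ≫ ψ.f) (toFrac Y _ _ h₁),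
        CostructuredArrow.homMk (f' ≫ ψ.s) (toFrac Y' _ _ h₂), trivial⟩
    · obtain ⟨A₁, k, s, hs, h⟩ := key Y'
      have hfg : L.map (f.left ≫ k) = L.map (g.left ≫ k) := by
        rw [L.map_comp, L.map_comp, ← h]
        have h₁ := CostructuredArrow.w f
        have h₂ := CostructuredArrow.w g
        rw [reassoc_of% h₁, reassoc_of% h₂]
      rw [MorphismProperty.map_eq_iff_postcomp L W] at hfg
      obtain ⟨A₂, s', hs', h'⟩ := hfg
      have h₁ : Y'.hom ≫ e.inv ≫ L.map (s ≫ s') = L.map (k ≫ s') := by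
        rw [L.map_comp, L.map_comp, reassoc_of% h]
      have := hL _ (W.comp_mem _ _ hs hs')
      refine ⟨CostructuredArrow.mk (Y := A₂) (inv (L.map (s ≫ s')) ≫ e.hom),
        CostructuredArrow.homMk (k ≫ s') (toFrac Y' _ _ h₁), ?_⟩
      ext
      simpa using h'
    · exact ⟨CostructuredArrow.mk e.hom⟩

/-- The index categories of the two-sided fractions are filtered. -/
lemma isFiltered_costructuredArrow_prod (L : C ⥤ D) (W : MorphismProperty C)
    [L.IsLocalization W] [W.HasLeftCalculusOfFractions] [W.HasRightCalculusOfFractions]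
    (d : Dᵒᵖ × D) : IsFiltered (CostructuredArrow (L.op.prod L) d) := by
  have := representablyCoflat_of_hasLeftCalculusOfFractions L W
  have := representablyCoflat_of_hasLeftCalculusOfFractions L.op W.op
  exact IsFiltered.of_equivalence (CostructuredArrow.prodEquivalence L.op L d.1 d.2).symm

end

/-! ### The localized bifunctor -/

section

variable {B D : Type u} [Category.{u} B] [Category.{u} D] (L : B ⥤ D) (W : MorphismProperty B)
  [L.IsLocalization W] [W.HasLeftCalculusOfFractions] [W.HasRightCalculusOfFractions]
  (G : Bᵒᵖ × B ⥤ AddCommGrpCat.{u})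

include W in
/-- Every element of the extension of a bifunctor `G` to the localization is of the form
`α_* ζ^* g`. -/
lemma bifunctorLan_exists_rep (d : Dᵒᵖ × D)
    (e : ((L.op.prod L).pointwiseLeftKanExtension G).obj d) :
    ∃ (z a : B) (ζ : d.1.unop ⟶ L.obj z) (α : L.obj a ⟶ d.2) (g : G.obj (op z, a)),
      e = ((L.op.prod L).pointwiseLeftKanExtension G).map
        (X := (op (L.obj z), L.obj a)) (Y := d) (ζ.op, α)
        (((L.op.prod L).pointwiseLeftKanExtensionUnit G).app (op z, a) g) := by
  have := isFiltered_costructuredArrow_prod L W d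
  obtain ⟨j, g, rfl⟩ := Concrete.isColimit_exists_rep _
    ((L.op.prod L).pointwiseLeftKanExtensionIsPointwiseLeftKanExtension G d) e
  exact ⟨j.left.1.unop, j.left.2, j.hom.1.unop, j.hom.2, g, rfl⟩

/-- An element of `G` which dies in the localization is annihilated by denominators. -/
lemma bifunctorLan_exists_eq_zero {z a : B} (g : G.obj (op z, a))
    (hg : ((L.op.prod L).pointwiseLeftKanExtensionUnit G).app (op z, a) g = 0) :
    ∃ (z' a' : B) (t : z' ⟶ z) (s : a ⟶ a'), W t ∧ W s ∧
      G.map (X := (op z, a)) (Y := (op z', a')) (t.op, s) g = 0 := by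
  have := isFiltered_costructuredArrow_prod L W (op (L.obj z), L.obj a)
  let j : CostructuredArrow (L.op.prod L) (op (L.obj z), L.obj a) :=
    CostructuredArrow.mk (Y := (op z, a)) (𝟙 _)
  obtain ⟨k, f, f', h⟩ := Concrete.isColimit_exists_of_rep_eq _
    ((L.op.prod L).pointwiseLeftKanExtensionIsPointwiseLeftKanExtension G
      (op (L.obj z), L.obj a)) (i := j) (j := j) g 0 (by
        refine Eq.trans ?_ (map_zero (AddCommGrpCat.Hom.hom _)).symm
        change ((L.op.prod L).pointwiseLeftKanExtension G).map (𝟙 _)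
          (((L.op.prod L).pointwiseLeftKanExtensionUnit G).app (op z, a) g) = 0
        rw [hg]
        simp)
  replace h : G.map f.left g = 0 := h.trans (map_zero (AddCommGrpCat.Hom.hom _))
  -- `f.left` consists of a retraction and a section up to localization; it divides denominators.
  have w₁ : k.hom.1.unop ≫ L.map f.left.1.unop = 𝟙 _ :=
    congrArg (fun φ => φ.1.unop) (CostructuredArrow.w f)
  have w₂ : L.map f.left.2 ≫ k.hom.2 = 𝟙 _ :=
    congrArg (fun φ => φ.2) (CostructuredArrow.w f)
  obtain ⟨φ, hφ⟩ := Localization.exists_leftFraction L W (X := k.left.2) (Y := a) k.hom.2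
  obtain ⟨ψ, hψ⟩ := Localization.exists_rightFraction L W (X := z) (Y := k.left.1.unop)
    k.hom.1.unop
  have eφ : L.map (f.left.2 ≫ φ.f) = L.map φ.s := by
    rw [L.map_comp, ← φ.map_comp_map_s L (Localization.inverts L W), ← hφ, reassoc_of% w₂]
  have eψ : L.map (ψ.f ≫ f.left.1.unop) = L.map ψ.s := by
    rw [L.map_comp, ← ψ.map_s_comp_map L (Localization.inverts L W), ← hψ, Category.assoc, w₁,
      Category.comp_id]
  rw [MorphismProperty.map_eq_iff_postcomp L W] at eφ
  rw [MorphismProperty.map_eq_iff_precomp L W] at eψ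
  obtain ⟨a', s, hs, eφ⟩ := eφ
  obtain ⟨z', t, ht, eψ⟩ := eψ
  refine ⟨z', a', t ≫ ψ.s, φ.s ≫ s, W.comp_mem _ _ ht ψ.hs, W.comp_mem _ _ φ.hs hs, ?_⟩
  have : (((t ≫ ψ.s).op, φ.s ≫ s) : (op z, a) ⟶ (op z', a')) =
      f.left ≫ (((t ≫ ψ.f).op, φ.f ≫ s) : k.left ⟶ (op z', a')) := by
    refine Prod.ext ?_ ?_
    · exact Quiver.Hom.unop_inj (by simpa using eψ.symm)
    · simpa using eφ.symm
  rw [this, G.map_comp]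
  refine (congrArg _ h).trans ?_
  exact map_zero (AddCommGrpCat.Hom.hom _)

end

/-! ### Localizations of extension data -/

section

variable {C : Type u} [Category.{v} C] [Preadditive C] {D : Type u'} [Category.{v'} D]
  [Preadditive D] {Q : C ⥤ D} {W : MorphismProperty C} {N : C → Prop}

namespace IsFractionLocalization

omit [Preadditive C] in
/-- Two parallel morphisms of `D` are left fractions with a common denominator. -/
lemma exists_left₂ (hQ : IsFractionLocalization Q W N) {A B : C} (f g : Q.obj A ⟶ Q.obj B) :
    ∃ (B' : C) (f' g' : A ⟶ B') (s : B ⟶ B'), IsIso (Q.map s) ∧ f ≫ Q.map s = Q.map f' ∧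
      g ≫ Q.map s = Q.map g' := by
  obtain ⟨B₁, f', s, hs, hf⟩ := hQ.exists_left f
  obtain ⟨B₂, g', s', hs', hg⟩ := hQ.exists_left (g ≫ Q.map s)
  refine ⟨B₂, f' ≫ s', g', s ≫ s', hQ.isIso_map (hQ.comp_mem hs hs'), ?_, ?_⟩
  · rw [Q.map_comp, Q.map_comp, reassoc_of% hf]
  · rw [Q.map_comp, ← hg, Category.assoc]

omit [Preadditive C] in
lemma exists_right₂ (hQ : IsFractionLocalization Q W N) {A B : C} (f g : Q.obj A ⟶ Q.obj B) :
    ∃ (A' : C) (f' g' : A' ⟶ B) (t : A' ⟶ A), IsIso (Q.map t) ∧ Q.map t ≫ f = Q.map f' ∧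
      Q.map t ≫ g = Q.map g' := by
  obtain ⟨A₁, f', t, ht, hf⟩ := hQ.exists_right f
  obtain ⟨A₂, g', t', ht', hg⟩ := hQ.exists_right (Q.map t ≫ g)
  refine ⟨A₂, t' ≫ f', g', t' ≫ t, hQ.isIso_map (hQ.comp_mem ht' ht), ?_, ?_⟩
  · rw [Q.map_comp, Q.map_comp, Category.assoc, hf]
  · rw [Q.map_comp, ← hg, Category.assoc]

variable [Q.Additive] {X : ExtData.{w} C} {P : Dᵒᵖ × D ⥤ AddCommGrpCat.{w'}}
  {μ : ∀ Z A : C, X.Ext Z A →+ P.obj (op (Q.obj Z), Q.obj A)}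
  (hμ : ∀ {Z Z' A A' : C} (c : Z' ⟶ Z) (a : A ⟶ A') (δ : X.Ext Z A),
    μ Z' A' (X.pushPull c a δ) = P.map (X := (op (Q.obj Z), Q.obj A))
      (Y := (op (Q.obj Z'), Q.obj A')) ((Q.map c).op, Q.map a) (μ Z A δ))
  (hrep : ∀ (d : Dᵒᵖ × D) (e : P.obj d), ∃ (Z A : C) (ζ : d.1.unop ⟶ Q.obj Z)
    (α : Q.obj A ⟶ d.2) (δ : X.Ext Z A), e = P.map (X := (op (Q.obj Z), Q.obj A)) (Y := d)
      (ζ.op, α) (μ Z A δ))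

include hμ hrep

omit [Q.Additive] in
/-- Every element of the localized bifunctor comes from an extension in `C`, up to isomorphisms of
both arguments. -/
lemma exists_iso_rep (hQ : IsFractionLocalization Q W N) {z a : D} (e : P.obj (op z, a)) :
    ∃ (Z A : C) (ζ : Q.obj Z ≅ z) (α : a ≅ Q.obj A) (δ : X.Ext Z A),
      P.map (X := (op z, a)) (Y := (op (Q.obj Z), Q.obj A)) (ζ.hom.op, α.hom) e = μ Z A δ := by
  obtain ⟨Z', A', ζ, α, δ, rfl⟩ := hrep _ e
  obtain ⟨Z₀, rfl⟩ := hQ.obj_surjective z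
  obtain ⟨A₀, rfl⟩ := hQ.obj_surjective a
  obtain ⟨A, g, s, hs, hg⟩ := hQ.exists_left α
  obtain ⟨Z, h, t, ht, hh⟩ := hQ.exists_right ζ
  have := hQ.isIso_map hs
  have := hQ.isIso_map ht
  refine ⟨Z, A, asIso (Q.map t), asIso (Q.map s), X.pushPull h g δ, ?_⟩
  rw [hμ, ← hg, ← hh, ← ConcreteCategory.comp_apply, ← P.map_comp]
  rfl

lemma map_add_right (hQ : IsFractionLocalization Q W N) {z a a' : D} (f g : a ⟶ a')
    (e : P.obj (op z, a)) :
    P.map (X := (op z, a)) (Y := (op z, a')) (𝟙 _, f + g) e =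
      P.map (X := (op z, a)) (Y := (op z, a')) (𝟙 _, f) e +
        P.map (X := (op z, a)) (Y := (op z, a')) (𝟙 _, g) e := by
  obtain ⟨Z, A, ζ, α, δ, h⟩ := exists_iso_rep hμ hrep hQ e
  obtain ⟨A', rfl⟩ := hQ.obj_surjective a'
  obtain ⟨A₁, f', g', s, hs, hf, hg⟩ := hQ.exists_left₂ (α.inv ≫ f) (α.inv ≫ g)
  -- Apply the isomorphism `(ζ, Q s)`; both sides then come from `C`.
  let ι : ((op z, Q.obj A') : Dᵒᵖ × D) ≅ (op (Q.obj Z), Q.obj A₁) :=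
    Iso.prod ζ.op (asIso (Q.map s))
  have key (k : a ⟶ Q.obj A') (k' : A ⟶ A₁) (hk : (α.inv ≫ k) ≫ Q.map s = Q.map k') :
      P.map ι.hom (P.map (X := (op z, a)) (Y := (op z, Q.obj A')) (𝟙 _, k) e) =
        μ Z A₁ (X.pushPull (𝟙 Z) k' δ) := by
    rw [hμ, ← h, ← ConcreteCategory.comp_apply, ← P.map_comp, ← ConcreteCategory.comp_apply,
      ← P.map_comp, ← hk]
    congr 3
    refine Prod.ext ?_ ?_ <;> simp [ι]
  apply (ConcreteCategory.bijective_of_isIso (P.map ι.hom)).1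
  rw [map_add, key f f' hf, key g g' hg, key (f + g) (f' + g') (by simp [← hf, ← hg]), ← map_add]
  simp [X.add_push]

lemma map_add_left (hQ : IsFractionLocalization Q W N) {z z' a : D} (f g : z' ⟶ z)
    (e : P.obj (op z, a)) :
    P.map (X := (op z, a)) (Y := (op z', a)) ((f + g).op, 𝟙 _) e =
      P.map (X := (op z, a)) (Y := (op z', a)) (f.op, 𝟙 _) e +
        P.map (X := (op z, a)) (Y := (op z', a)) (g.op, 𝟙 _) e := by
  obtain ⟨Z, A, ζ, α, δ, h⟩ := exists_iso_rep hμ hrep hQ e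
  obtain ⟨Z', rfl⟩ := hQ.obj_surjective z'
  obtain ⟨Z₁, f', g', t, ht, hf, hg⟩ := hQ.exists_right₂ (f ≫ ζ.inv) (g ≫ ζ.inv)
  let ι : ((op (Q.obj Z'), a) : Dᵒᵖ × D) ≅ (op (Q.obj Z₁), Q.obj A) :=
    Iso.prod (asIso (Q.map t)).op α
  have key (k : Q.obj Z' ⟶ z) (k' : Z₁ ⟶ Z) (hk : Q.map t ≫ k ≫ ζ.inv = Q.map k') :
      P.map ι.hom (P.map (X := (op z, a)) (Y := (op (Q.obj Z'), a)) (k.op, 𝟙 _) e) =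
        μ Z₁ A (X.pushPull k' (𝟙 A) δ) := by
    rw [hμ, ← h, ← ConcreteCategory.comp_apply, ← P.map_comp, ← ConcreteCategory.comp_apply,
      ← P.map_comp, ← hk]
    congr 3
    refine Prod.ext ?_ ?_ <;> simp [ι, ← op_comp]
  apply (ConcreteCategory.bijective_of_isIso (P.map ι.hom)).1
  rw [map_add, key f f' hf, key g g' hg, key (f + g) (f' + g') (by simp [← hf, ← hg]), ← map_add]
  simp [X.add_pull]

end IsFractionLocalization

/-- `(Y, μ)` is a localization of `(X, E)` along `Q`: the transformation `μ` is natural, an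
extension killed by `μ` is annihilated by members of `W`, and every extension in `D` is, up to
isomorphisms of the end terms, the image of an extension `δ` in `C` and realized by the image of
the `s`-triangle of `δ`. -/
structure IsExtLocalization (X : ExtData.{w} C) (Q : C ⥤ D) (W : MorphismProperty C)
    (Y : ExtData.{w'} D) (μ : ∀ Z A : C, X.Ext Z A →+ Y.Ext (Q.obj Z) (Q.obj A)) : Prop where
  map_push : ∀ {Z A A' : C} (a : A ⟶ A') (δ : X.Ext Z A),
    μ Z A' (X.push a δ) = Y.push (Q.map a) (μ Z A δ)
  map_pull : ∀ {Z Z' A : C} (c : Z' ⟶ Z) (δ : X.Ext Z A),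
    μ Z' A (X.pull c δ) = Y.pull (Q.map c) (μ Z A δ)
  exists_eq_zero : ∀ {Z A : C} (δ : X.Ext Z A), μ Z A δ = 0 →
    ∃ (Z' A' : C) (t : Z' ⟶ Z) (s : A ⟶ A'), W t ∧ W s ∧ X.push s (X.pull t δ) = 0
  exists_isTriangle : ∀ {z a : D} (e : Y.Ext z a), ∃ (A B Z : C) (x : A ⟶ B) (y : B ⟶ Z)
    (δ : X.Ext Z A) (ζ : Q.obj Z ≅ z) (α : a ≅ Q.obj A), X.IsTriangle x y δ ∧
      Y.push α.hom (Y.pull ζ.hom e) = μ Z A δ ∧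
      Y.IsTriangle (α.hom ≫ Q.map x) (Q.map y ≫ ζ.hom) e

variable [Q.Additive] {X : ExtData.{w} C}

/-- A localization of the bifunctor `E` extends to a localization of the extension data: choose for
each extension of `D` an extension of `C` and a realization of it. -/
lemma IsFractionLocalization.exists_isExtLocalization (hQ : IsFractionLocalization Q W N)
    {P : Dᵒᵖ × D ⥤ AddCommGrpCat.{w'}}
    {μ : ∀ Z A : C, X.Ext Z A →+ P.obj (op (Q.obj Z), Q.obj A)}
    (hμ : ∀ {Z Z' A A' : C} (c : Z' ⟶ Z) (a : A ⟶ A') (δ : X.Ext Z A),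
      μ Z' A' (X.pushPull c a δ) = P.map (X := (op (Q.obj Z), Q.obj A))
        (Y := (op (Q.obj Z'), Q.obj A')) ((Q.map c).op, Q.map a) (μ Z A δ))
    (hrep : ∀ (d : Dᵒᵖ × D) (e : P.obj d), ∃ (Z A : C) (ζ : d.1.unop ⟶ Q.obj Z)
      (α : Q.obj A ⟶ d.2) (δ : X.Ext Z A), e = P.map (X := (op (Q.obj Z), Q.obj A)) (Y := d)
        (ζ.op, α) (μ Z A δ))
    (hzero : ∀ {Z A : C} (δ : X.Ext Z A), μ Z A δ = 0 →
      ∃ (Z' A' : C) (t : Z' ⟶ Z) (s : A ⟶ A'), W t ∧ W s ∧ X.pushPull t s δ = 0) :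
    ∃ (Y : ExtData.{w'} D) (ν : ∀ Z A : C, X.Ext Z A →+ Y.Ext (Q.obj Z) (Q.obj A)),
      IsExtLocalization X Q W Y ν := by
  have hseq {z a : D} (e : P.obj (op z, a)) : ∃ (T : TwoSeq a z) (A B Z : C) (x : A ⟶ B)
      (y : B ⟶ Z) (δ : X.Ext Z A) (ζ : Q.obj Z ≅ z) (α : a ≅ Q.obj A), X.IsTriangle x y δ ∧
      P.map (X := (op z, a)) (Y := (op (Q.obj Z), Q.obj A)) (ζ.hom.op, α.hom) e = μ Z A δ ∧
      T = ⟨Q.obj B, α.hom ≫ Q.map x, Q.map y ≫ ζ.hom⟩ := by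
    obtain ⟨Z, A, ζ, α, δ, h⟩ := exists_iso_rep hμ hrep hQ e
    obtain ⟨B, x, y, hxy⟩ := X.exists_isTriangle δ
    exact ⟨_, A, B, Z, x, y, δ, ζ, α, hxy, h, rfl⟩
  let Y : ExtData.{w'} D :=
    { E := Functor.curry.obj P
      additive_left := ⟨fun {z z' f g} => by
        ext a e
        exact map_add_left hμ hrep hQ f.unop g.unop e⟩
      additive_right := fun z => ⟨fun {a a' f g} => by
        ext e
        exact map_add_right hμ hrep hQ f g e⟩
      s := fun e => Quotient.mk _ (hseq e).choose }
  have hY {z z' a a' : D} (ζ : z' ⟶ z) (α : a ⟶ a') (e : Y.Ext z a) :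
      Y.push α (Y.pull ζ e) = P.map (X := (op z, a)) (Y := (op z', a')) (ζ.op, α) e := by
    change P.map (X := (op z', a)) (Y := (op z', a')) (𝟙 _, α)
      (P.map (X := (op z, a)) (Y := (op z', a)) (ζ.op, 𝟙 _) e) = _
    rw [← ConcreteCategory.comp_apply, ← P.map_comp]
    congr 3
    exact Prod.ext (Category.comp_id _) (Category.id_comp _)
  refine ⟨Y, μ, fun a δ => ?_, fun c δ => ?_, fun δ h => hzero δ h, fun {z a} e => ?_⟩
  · have := hμ (𝟙 _) a δ
    rw [X.pushPull_apply, X.pull_id] at this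
    rw [this, ← Y.pull_id (μ _ _ δ), ← Q.map_id, hY, Q.map_id, op_id, Y.pull_id]
  · have := hμ c (𝟙 _) δ
    rw [X.pushPull_apply, X.push_id] at this
    rw [this, ← Y.push_id (Y.pull (Q.map c) _), ← Q.map_id, hY]
  · obtain ⟨A, B, Z, x, y, δ, ζ, α, hxy, h, hT⟩ := (hseq e).choose_spec
    exact ⟨A, B, Z, x, y, δ, ζ, α, hxy, (hY _ _ _).trans h, congrArg (Quotient.mk _) hT⟩

end

section

variable {C : Type u} [SmallCategory.{u} C] [Preadditive C] [HasFiniteBiproducts C]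
  {X : ExtData.{u} C} {S : MorphismProperty C}

lemma exists_isExtLocalization (hX : X.IsWeaklyExtriangulated) (h0 : M0 S) (h2 : MR2 S)
    (h3 : MR3 X S) :
    letI := locPreadditive h0 h2
    ∃ (Y : ExtData.{u} S.Localization)
      (μ : ∀ Z A : C, X.Ext Z A →+ Y.Ext (S.Q.obj Z) (S.Q.obj A)),
      IsExtLocalization X S.Q (Slift S) Y μ := by
  let := locPreadditive h0 h2
  have := Q_additive h0 h2
  have hQ := isFractionLocalization_Q h0 h2
  have := h0.isLocalization
  have := h2.1
  have := h2.2
  have : (Slift S).IsMultiplicative :=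
    { id_mem := hQ.id_mem
      comp_mem := fun _ _ => hQ.comp_mem }
  let L := h0.quotLocalization
  let G := extQuotient X S hX h0 h3
  let η := (L.op.prod L).pointwiseLeftKanExtensionUnit G
  let μ (Z A : C) : X.Ext Z A →+
      ((L.op.prod L).pointwiseLeftKanExtension G).obj (op (S.Q.obj Z), S.Q.obj A) :=
    (η.app (op ((quotFunctor S).obj Z), (quotFunctor S).obj A)).hom.comp
      (QuotientAddGroup.mk' (X.vanishing (Slift S) Z A))
  refine hQ.exists_isExtLocalization (μ := μ) ?_ ?_ ?_
  · intro Z Z' A A' c a δ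
    have := ConcreteCategory.congr_hom (η.naturality
      (X := (op ((quotFunctor S).obj Z), (quotFunctor S).obj A))
      (Y := (op ((quotFunctor S).obj Z'), (quotFunctor S).obj A'))
      (((quotFunctor S).map c).op, (quotFunctor S).map a)) (QuotientAddGroup.mk δ)
    exact (congrArg _ (extQuotient_map_mk hX h0 h3 c a δ)).symm.trans this
  · intro d e
    obtain ⟨z, a, ζ, α, g, h⟩ := bifunctorLan_exists_rep L (Sbar S) G d e
    obtain ⟨δ, rfl⟩ := QuotientAddGroup.mk_surjective g
    exact ⟨z.as, a.as, ζ, α, δ, h⟩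
  · intro Z A δ h
    obtain ⟨z, a, t, s, ht, hs, h⟩ := bifunctorLan_exists_eq_zero L (Sbar S) G
      (z := (quotFunctor S).obj Z) (a := (quotFunctor S).obj A) (QuotientAddGroup.mk δ) h
    obtain ⟨t, rfl⟩ := (quotFunctor S).map_surjective (X := z.as) (Y := Z) t
    obtain ⟨s, rfl⟩ := (quotFunctor S).map_surjective (X := A) (Y := a.as) s
    replace h := (extQuotient_map_mk hX h0 h3 t s δ).symm.trans h
    obtain ⟨Z', A', t', s', ht', hs', h'⟩ := (QuotientAddGroup.eq_zero_iff _).1 h (𝟙 _) (𝟙 _)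
    refine ⟨Z', A', t' ≫ t, s ≫ s', hQ.comp_mem ht' ht, hQ.comp_mem hs hs', ?_⟩
    rw [X.pushPull_comp]
    simpa using h'

end

/-! ### The localization is weakly extriangulated -/

section

variable {C : Type u} [Category.{v} C] [Preadditive C] [HasFiniteBiproducts C]
  {D : Type u'} [Category.{v'} D] [Preadditive D]

/-- The data of `IsFractionLocalization` and `IsExtLocalization`, together with the compatibility
of `Q` with triangles: the consequences of (MR3) which do not mention the ideal quotient. -/
structure IsTriangleLocalization (X : ExtData.{w} C) (Q : C ⥤ D) (W : MorphismProperty C)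
    (N : C → Prop) (Y : ExtData.{w'} D)
    (μ : ∀ Z A : C, X.Ext Z A →+ Y.Ext (Q.obj Z) (Q.obj A)) : Prop where
  weak : X.IsWeaklyExtriangulated
  frac : IsFractionLocalization Q W N
  ext : IsExtLocalization X Q W Y μ
  exists_mid_iso : ∀ {A B Z A' B' Z' : C} {x : A ⟶ B} {y : B ⟶ Z} {δ : X.Ext Z A}
    {x' : A' ⟶ B'} {y' : B' ⟶ Z'} {δ' : X.Ext Z' A'} {a : A ⟶ A'} {c : Z ⟶ Z'},
    X.IsTriangle x y δ → X.IsTriangle x' y' δ' → X.push a δ = X.pull c δ' → W a → W c →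
    ∃ β : Q.obj B ≅ Q.obj B', Q.map x ≫ β.hom = Q.map a ≫ Q.map x' ∧
      β.hom ≫ Q.map y' = Q.map y ≫ Q.map c
  isIso_inflation : ∀ {A M K : C} {s : A ⟶ M} {q : M ⟶ K} {ε : X.Ext K A},
    X.IsTriangle s q ε → N K → IsIso (Q.map s)
  isIso_deflation : ∀ {K M Z : C} {i : K ⟶ M} {t : M ⟶ Z} {ε : X.Ext Z K},
    X.IsTriangle i t ε → N K → IsIso (Q.map t)

namespace IsTriangleLocalization

variable {X : ExtData.{w} C} {Q : C ⥤ D} [Q.Additive] {W : MorphismProperty C} {N : C → Prop}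
  {Y : ExtData.{w'} D} {μ : ∀ Z A : C, X.Ext Z A →+ Y.Ext (Q.obj Z) (Q.obj A)}
  (H : IsTriangleLocalization X Q W N Y μ)

include H

/-- `Q` sends triangles to exact sequences. A morphism into `Q B` or `Q Z`, or out of `Q A` or
`Q B`, is represented by a morphism of `C`, for which the exactness holds after replacing the
triangle by another one with an isomorphic image in `D`, or one of its terms by an object which
becomes isomorphic to it. -/
lemma isExactSeq_map {A B Z : C} {x : A ⟶ B} {y : B ⟶ Z} {δ : X.Ext Z A}
    (h : X.IsTriangle x y δ) : Y.IsExactSeq (Q.map x) (Q.map y) (μ Z A δ) := by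
  have hex := H.weak.isExactSeq h
  refine ⟨?_, ?_, ?_, fun {V} g hg => ?_, fun {V} g hg => ?_, fun {V} g hg => ?_,
    fun {V} g hg => ?_⟩
  · rw [← Q.map_comp, hex.comp_eq_zero, Q.map_zero]
  · rw [← H.ext.map_pull, hex.pull_eq_zero, map_zero]
  · rw [← H.ext.map_push, hex.push_eq_zero, map_zero]
  · -- In `C`, the composite `t' ≫ g' ≫ y` factors through a null object `K`; the middle term of the
    -- triangle of `j^* δ` over `K` receives a lift and differs from `A` by a denominator.
    obtain ⟨V, rfl⟩ := H.frac.obj_surjective V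
    obtain ⟨V₁, g', t, ht, hg'⟩ := H.frac.exists_right g
    obtain ⟨V₂, K, t', i, j, ht', hK, hij⟩ := H.frac.right_null (f := g' ≫ y) (by
      rw [Q.map_comp, ← hg', Category.assoc, hg, comp_zero])
    obtain ⟨M, s, q, hsq⟩ := X.exists_isTriangle (X.pull j δ)
    have := H.isIso_inflation hsq hK
    have := H.frac.isIso_map (H.frac.comp_mem ht' ht)
    obtain ⟨b, hsb, -, hb⟩ := H.weak.base_change x y δ j s q h hsq
    obtain ⟨k, hk⟩ := (H.weak.isExactSeq hb).lift_inflation (biprod.lift (-i) (t' ≫ g'))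
      (by simp [biprod.lift_desc, hij])
    have hkb : k ≫ b = t' ≫ g' := by simpa using congrArg (· ≫ biprod.snd) hk
    refine ⟨inv (Q.map (t' ≫ t)) ≫ Q.map k ≫ inv (Q.map s), ?_⟩
    rw [Category.assoc, IsIso.inv_comp_eq, ← hsb, Q.map_comp s b, Category.assoc,
      IsIso.inv_hom_id_assoc, ← Q.map_comp, hkb, Q.map_comp, Q.map_comp, Category.assoc, hg']
  · obtain ⟨V, rfl⟩ := H.frac.obj_surjective V
    obtain ⟨V₁, g', t, ht, hg'⟩ := H.frac.exists_right g
    obtain ⟨V₂, A', t', s, ht', hs, h₀⟩ := H.ext.exists_eq_zero (X.pull g' δ) (by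
      rw [H.ext.map_pull, ← hg', Y.pull_comp, hg, Y.pull_zero])
    obtain ⟨M, i, p, hM⟩ := X.exists_isTriangle (X.push s δ)
    rw [← X.pull_comp, X.push_pull] at h₀
    obtain ⟨k, hk⟩ := (H.weak.isExactSeq hM).lift_deflation _ h₀
    obtain ⟨β, -, hβ⟩ := H.exists_mid_iso (a := s) (c := 𝟙 Z) h hM (by simp) hs (H.frac.id_mem _)
    have := H.frac.isIso_map (H.frac.comp_mem ht' ht)
    have hβ' : β.inv ≫ Q.map y = Q.map p := by
      rw [Iso.inv_comp_eq, hβ, Q.map_id, Category.comp_id]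
    refine ⟨inv (Q.map (t' ≫ t)) ≫ Q.map k ≫ β.inv, ?_⟩
    rw [Category.assoc, IsIso.inv_comp_eq, Category.assoc, hβ', ← Q.map_comp, hk, Q.map_comp,
      Q.map_comp, Category.assoc, hg']
  · obtain ⟨V, rfl⟩ := H.frac.obj_surjective V
    obtain ⟨V₁, g', s, hs, hg'⟩ := H.frac.exists_left g
    obtain ⟨V₂, K, s', i, j, hs', hK, hij⟩ := H.frac.left_null (f := x ≫ g') (by
      rw [Q.map_comp, ← hg', reassoc_of% hg, zero_comp])
    obtain ⟨M, q, t, hqt⟩ := X.exists_isTriangle (X.push i δ)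
    have := H.isIso_deflation hqt hK
    have := H.frac.isIso_map (H.frac.comp_mem hs hs')
    obtain ⟨b, -, hbt, hb⟩ := H.weak.cobase_change x y δ i q t h hqt
    obtain ⟨k, hk⟩ := (H.weak.isExactSeq hb).desc_deflation (biprod.desc (g' ≫ s') (-j))
      (by rw [Category.assoc] at hij; simp [biprod.lift_desc, hij])
    have hbk : b ≫ k = g' ≫ s' := by simpa using congrArg (biprod.inl ≫ ·) hk
    refine ⟨inv (Q.map t) ≫ Q.map k ≫ inv (Q.map (s ≫ s')), ?_⟩
    rw [← Category.assoc, ← Category.assoc, IsIso.comp_inv_eq, ← hbt, Q.map_comp b t,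
      Category.assoc (Q.map b), IsIso.hom_inv_id, Category.comp_id, ← Q.map_comp, hbk, Q.map_comp,
      Q.map_comp, reassoc_of% hg']
  · obtain ⟨V, rfl⟩ := H.frac.obj_surjective V
    obtain ⟨V₁, g', s, hs, hg'⟩ := H.frac.exists_left g
    obtain ⟨Z', V₂, t, s', ht, hs', h₀⟩ := H.ext.exists_eq_zero (X.push g' δ) (by
      rw [H.ext.map_push, ← hg', Y.push_comp, hg, Y.push_zero])
    obtain ⟨M, i, p, hM⟩ := X.exists_isTriangle (X.pull t δ)
    rw [← X.push_pull, ← X.push_comp] at h₀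
    obtain ⟨k, hk⟩ := (H.weak.isExactSeq hM).desc_inflation _ h₀
    obtain ⟨β, hβ, -⟩ := H.exists_mid_iso (a := 𝟙 A) (c := t) hM h (by simp) (H.frac.id_mem _) ht
    have := H.frac.isIso_map (H.frac.comp_mem hs hs')
    have hβ' : Q.map x ≫ β.inv = Q.map i := by
      rw [Iso.comp_inv_eq, hβ, Q.map_id, Category.id_comp]
    refine ⟨β.inv ≫ Q.map k ≫ inv (Q.map (s ≫ s')), ?_⟩
    rw [← Category.assoc, ← Category.assoc, IsIso.comp_inv_eq, hβ', ← Q.map_comp, hk, Q.map_comp,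
      Q.map_comp, reassoc_of% hg']

omit [Q.Additive] in
/-- A morphism in `D` between the images of two extensions of `C` extends to a morphism of the
images of their triangles: write both components as fractions and pass to a common
denominator. -/
lemma exists_mid_map {A B Z A' B' Z' : C} {x : A ⟶ B} {y : B ⟶ Z} {δ : X.Ext Z A}
    {x' : A' ⟶ B'} {y' : B' ⟶ Z'} {δ' : X.Ext Z' A'} (h : X.IsTriangle x y δ)
    (h' : X.IsTriangle x' y' δ') (a : Q.obj A ⟶ Q.obj A') (c : Q.obj Z ⟶ Q.obj Z')
    (hac : Y.push a (μ Z A δ) = Y.pull c (μ Z' A' δ')) :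
    ∃ b : Q.obj B ⟶ Q.obj B', Q.map x ≫ b = a ≫ Q.map x' ∧ b ≫ Q.map y' = Q.map y ≫ c := by
  obtain ⟨A₁, a₁, s₁, hs₁, ha₁⟩ := H.frac.exists_left a
  obtain ⟨Z₁, c₁, t₁, ht₁, hc₁⟩ := H.frac.exists_right c
  obtain ⟨Z₂, A₂, t₂, s₂, ht₂, hs₂, h₀⟩ := H.ext.exists_eq_zero
    (X.push a₁ (X.pull t₁ δ) - X.push s₁ (X.pull c₁ δ')) (by
      rw [map_sub, H.ext.map_push, H.ext.map_pull, H.ext.map_push, H.ext.map_pull, ← ha₁, ← hc₁,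
        Y.push_pull, Y.push_comp, hac, Y.push_pull, Y.pull_comp, Y.push_pull, Y.push_pull,
        sub_self])
  have e : X.push (a₁ ≫ s₂) (X.pull (t₂ ≫ t₁) δ) =
      X.pull (t₂ ≫ c₁) (X.push (s₁ ≫ s₂) δ') := by
    rw [sub_eq_add_neg, X.pull_add, X.push_add, X.pull_neg, X.push_neg, add_neg_eq_zero] at h₀
    simpa only [X.push_comp, X.pull_comp, X.push_pull] using h₀
  have ht := H.frac.comp_mem ht₂ ht₁
  have hs := H.frac.comp_mem hs₁ hs₂
  have := H.frac.isIso_map ht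
  have := H.frac.isIso_map hs
  obtain ⟨M, i, p, hM⟩ := X.exists_isTriangle (X.pull (t₂ ≫ t₁) δ)
  obtain ⟨M', i', p', hM'⟩ := X.exists_isTriangle (X.push (s₁ ≫ s₂) δ')
  obtain ⟨b, hb, hb'⟩ := H.weak.exists_mid hM hM' _ _ e
  obtain ⟨β, hβ, hβ'⟩ := H.exists_mid_iso (a := 𝟙 A) hM h (by simp) (H.frac.id_mem _) ht
  obtain ⟨γ, hγ, hγ'⟩ := H.exists_mid_iso (c := 𝟙 Z') h' hM' (by simp) hs (H.frac.id_mem _)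
  rw [Q.map_id, Category.id_comp] at hβ
  rw [Q.map_id, Category.comp_id] at hγ'
  refine ⟨β.inv ≫ Q.map b ≫ γ.inv, ?_, ?_⟩
  · rw [← hβ, Category.assoc, Iso.hom_inv_id_assoc, ← Category.assoc, Iso.comp_inv_eq,
      Category.assoc, hγ, ← Q.map_comp, hb, Q.map_comp, Q.map_comp, ← ha₁, Q.map_comp]
    simp
  · rw [← hγ', Category.assoc, Category.assoc, Iso.inv_hom_id_assoc, Iso.inv_comp_eq, ← Q.map_comp,
      hb', Q.map_comp, ← Category.assoc, hβ', Q.map_comp, Q.map_comp, Category.assoc,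
      Category.assoc, hc₁]

omit [Q.Additive] in
/-- Every triangle of `D` is isomorphic to the image of a triangle of `C`. -/
lemma exists_iso_of_isTriangle {a b z : D} {x : a ⟶ b} {y : b ⟶ z} {e : Y.Ext z a}
    (h : Y.IsTriangle x y e) : ∃ (A B Z : C) (x₀ : A ⟶ B) (y₀ : B ⟶ Z) (δ : X.Ext Z A)
      (α : Q.obj A ≅ a) (β : Q.obj B ≅ b) (γ : Q.obj Z ≅ z), X.IsTriangle x₀ y₀ δ ∧
      Q.map x₀ ≫ β.hom = α.hom ≫ x ∧ Q.map y₀ ≫ γ.hom = β.hom ≫ y ∧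
      Y.push α.hom (μ Z A δ) = Y.pull γ.hom e := by
  obtain ⟨A, B, Z, x₀, y₀, δ, ζ, α, h₀, he, h₁⟩ := H.ext.exists_isTriangle e
  obtain ⟨β, hβ, hβ'⟩ := h₁.exists_iso h
  refine ⟨A, B, Z, x₀, y₀, δ, α.symm, β, ζ, h₀, ?_, hβ'.symm, ?_⟩
  · simp [← hβ]
  · rw [← he, ← Y.push_comp]
    simp

/-- Every sequence isomorphic to the image of a triangle is a triangle. -/
lemma isTriangle_of_iso_map {A B Z : C} {x₀ : A ⟶ B} {y₀ : B ⟶ Z} {δ : X.Ext Z A}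
    {a b z : D} {x : a ⟶ b} {y : b ⟶ z} {e : Y.Ext z a} (h : X.IsTriangle x₀ y₀ δ)
    (α : Q.obj A ≅ a) (β : Q.obj B ≅ b) (γ : Q.obj Z ≅ z) (hx : Q.map x₀ ≫ β.hom = α.hom ≫ x)
    (hy : Q.map y₀ ≫ γ.hom = β.hom ≫ y) (he : Y.push α.hom (μ Z A δ) = Y.pull γ.hom e) :
    Y.IsTriangle x y e := by
  obtain ⟨A₁, B₁, Z₁, x₁, y₁, δ₁, ζ, α₁, h₁, he₁, hT⟩ := H.ext.exists_isTriangle e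
  have hδ : Y.push (α.hom ≫ α₁.hom) (μ Z A δ) = Y.pull (γ.hom ≫ ζ.inv) (μ Z₁ A₁ δ₁) := by
    rw [Y.push_comp, he, Y.pull_comp, ← he₁, ← Y.push_pull α₁.hom ζ.inv, ← Y.pull_comp ζ.hom,
      Y.push_pull]
    simp
  obtain ⟨b', hb, hb'⟩ := H.exists_mid_map h h₁ _ _ hδ
  have := (H.isExactSeq_map h).isIso_mid (H.isExactSeq_map h₁) hb hb' hδ
  refine hT.of_iso_mid ((asIso b').symm ≪≫ β) ?_ ?_
  · have : (α.hom ≫ α₁.hom) ≫ Q.map x₁ ≫ inv b' ≫ β.hom = α.hom ≫ x := by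
      rw [← Category.assoc _ (Q.map x₁), ← hb]
      simp [hx]
    rw [Category.assoc, cancel_epi α.hom] at this
    simpa using this
  · have : b' ≫ Q.map y₁ ≫ ζ.hom = Q.map y₀ ≫ γ.hom := by
      rw [← Category.assoc, hb']
      simp
    simp [← hy, ← this]

lemma isExactSeq {a b z : D} {x : a ⟶ b} {y : b ⟶ z} {e : Y.Ext z a} (h : Y.IsTriangle x y e) :
    Y.IsExactSeq x y e := by
  obtain ⟨A, B, Z, x₀, y₀, δ, α, β, γ, h₀, hx, hy, he⟩ := H.exists_iso_of_isTriangle h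
  exact (H.isExactSeq_map h₀).of_iso α β γ hx hy he

/-- An isomorphism from the image of an extension of `C` to an extension of `D` extends to an
isomorphism of triangles. -/
lemma exists_iso_mid {A B Z : C} {x₀ : A ⟶ B} {y₀ : B ⟶ Z} {δ : X.Ext Z A}
    {a b z : D} {x : a ⟶ b} {y : b ⟶ z} {e : Y.Ext z a} (h : X.IsTriangle x₀ y₀ δ)
    (h' : Y.IsTriangle x y e) (α : Q.obj A ≅ a) (γ : Q.obj Z ≅ z)
    (he : Y.push α.hom (μ Z A δ) = Y.pull γ.hom e) :
    ∃ β : Q.obj B ≅ b, Q.map x₀ ≫ β.hom = α.hom ≫ x ∧ β.hom ≫ y = Q.map y₀ ≫ γ.hom := by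
  have h₁ : Y.IsTriangle (α.inv ≫ Q.map x₀) (Q.map y₀ ≫ γ.hom) e :=
    H.isTriangle_of_iso_map h α (Iso.refl _) γ (by simp) (by simp) he
  obtain ⟨β, hβ, hβ'⟩ := h₁.exists_iso h'
  exact ⟨β, by simp [← hβ], hβ'⟩

lemma isTriangle_map {A B Z : C} {x : A ⟶ B} {y : B ⟶ Z} {δ : X.Ext Z A}
    (h : X.IsTriangle x y δ) : Y.IsTriangle (Q.map x) (Q.map y) (μ Z A δ) :=
  H.isTriangle_of_iso_map h (Iso.refl _) (Iso.refl _) (Iso.refl _) (by simp) (by simp) (by simp)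

end IsTriangleLocalization

/-- The isomorphism `Q (B₁ ⊞ B₂) ≅ b₁ ⊞ b₂` induced by isomorphisms `Q B₁ ≅ b₁`, `Q B₂ ≅ b₂`. -/
noncomputable def mapBiprodIso [HasFiniteBiproducts D] (Q : C ⥤ D) [Q.Additive] {B₁ B₂ : C}
    {b₁ b₂ : D} (β₁ : Q.obj B₁ ≅ b₁) (β₂ : Q.obj B₂ ≅ b₂) : Q.obj (B₁ ⊞ B₂) ≅ b₁ ⊞ b₂ where
  hom := biprod.lift (Q.map biprod.fst ≫ β₁.hom) (Q.map biprod.snd ≫ β₂.hom)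
  inv := biprod.desc (β₁.inv ≫ Q.map biprod.inl) (β₂.inv ≫ Q.map biprod.inr)
  hom_inv_id := by
    rw [biprod.lift_desc]
    simp only [Category.assoc, Iso.hom_inv_id_assoc, ← Q.map_comp, ← Q.map_add, biprod.total,
      Q.map_id]
  inv_hom_id := by
    have h₁ : Q.map (biprod.inl : B₁ ⟶ B₁ ⊞ B₂) ≫ Q.map biprod.fst = 𝟙 _ := by
      rw [← Q.map_comp, biprod.inl_fst, Q.map_id]
    have h₂ : Q.map (biprod.inl : B₁ ⟶ B₁ ⊞ B₂) ≫ Q.map biprod.snd = 0 := by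
      rw [← Q.map_comp, biprod.inl_snd, Q.map_zero]
    have h₃ : Q.map (biprod.inr : B₂ ⟶ B₁ ⊞ B₂) ≫ Q.map biprod.fst = 0 := by
      rw [← Q.map_comp, biprod.inr_fst, Q.map_zero]
    have h₄ : Q.map (biprod.inr : B₂ ⟶ B₁ ⊞ B₂) ≫ Q.map biprod.snd = 𝟙 _ := by
      rw [← Q.map_comp, biprod.inr_snd, Q.map_id]
    ext <;> simp only [Category.assoc, biprod.inl_desc_assoc, biprod.inr_desc_assoc,
      biprod.lift_fst, biprod.lift_snd, reassoc_of% h₁, reassoc_of% h₂, reassoc_of% h₃,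
      reassoc_of% h₄, zero_comp, comp_zero, Iso.inv_hom_id, Category.comp_id, biprod.inl_fst,
      biprod.inl_snd, biprod.inr_fst, biprod.inr_snd]

lemma map_biprod_desc (Q : C ⥤ D) [Q.Additive] {B₁ B₂ B : C} (f : B₁ ⟶ B) (g : B₂ ⟶ B) :
    Q.map (biprod.desc f g) =
      Q.map biprod.fst ≫ Q.map f + Q.map biprod.snd ≫ Q.map g := by
  rw [biprod.desc_eq, Q.map_add, Q.map_comp, Q.map_comp]

namespace IsTriangleLocalization

variable [HasFiniteBiproducts D] {X : ExtData.{w} C} {Q : C ⥤ D} [Q.Additive]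
  {W : MorphismProperty C} {N : C → Prop}
  {Y : ExtData.{w'} D} {μ : ∀ Z A : C, X.Ext Z A →+ Y.Ext (Q.obj Z) (Q.obj A)}
  (H : IsTriangleLocalization X Q W N Y μ)

include H

lemma cobase_change {a b z a' b' : D} {x : a ⟶ b} {y : b ⟶ z} {e : Y.Ext z a} {f : a ⟶ a'}
    {x' : a' ⟶ b'} {y' : b' ⟶ z} (h : Y.IsTriangle x y e) (h' : Y.IsTriangle x' y' (Y.push f e)) :
    ∃ g : b ⟶ b', x ≫ g = f ≫ x' ∧ g ≫ y' = y ∧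
      Y.IsTriangle (biprod.lift x f) (biprod.desc g (-x')) (Y.pull y' e) := by
  obtain ⟨A, B, Z, x₀, y₀, δ, α, β, γ, h₀, hx, hy, he⟩ := H.exists_iso_of_isTriangle h
  obtain ⟨A', rfl⟩ := H.frac.obj_surjective a'
  obtain ⟨A₁, f₀, s, hs, hf₀⟩ := H.frac.exists_left (α.hom ≫ f)
  have := H.frac.isIso_map hs
  obtain ⟨B₁, x₁, y₁, h₁⟩ := X.exists_isTriangle (X.push f₀ δ)
  obtain ⟨g₀, hg₀, hg₀', hT⟩ := H.weak.cobase_change x₀ y₀ δ f₀ x₁ y₁ h₀ h₁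
  obtain ⟨β', hβ', hβ''⟩ := H.exists_iso_mid h₁ h' (asIso (Q.map s)).symm γ (by
    rw [H.ext.map_push, ← hf₀, ← Y.push_comp, ← Y.push_pull, ← he, ← Y.push_comp]
    simp)
  have hf₁ : Q.map f₀ ≫ inv (Q.map s) = α.hom ≫ f := by simp [← hf₀]
  have hx₁ : Q.map x₁ ≫ β'.hom = inv (Q.map s) ≫ x' := by simpa using hβ'
  refine ⟨β.inv ≫ Q.map g₀ ≫ β'.hom, ?_, ?_, ?_⟩
  · rw [← cancel_epi α.hom, ← reassoc_of% hx, Iso.hom_inv_id_assoc, ← Q.map_comp_assoc, hg₀,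
      Q.map_comp, Category.assoc, hx₁, reassoc_of% hf₁]
  · rw [Category.assoc, Category.assoc, hβ'', ← Q.map_comp_assoc, hg₀', hy, Iso.inv_hom_id_assoc]
  · refine H.isTriangle_of_iso_map hT α (mapBiprodIso Q β (asIso (Q.map s)).symm) β' ?_ ?_ ?_
    · ext <;> simp [mapBiprodIso, ← Functor.map_comp_assoc, hx, hf₁]
    · simp only [mapBiprodIso, biprod.lift_desc, map_biprod_desc, Q.map_neg,
        Preadditive.add_comp, Preadditive.comp_neg, Preadditive.neg_comp, Category.assoc,
        Iso.hom_inv_id_assoc, hx₁, Iso.symm_hom, asIso_inv]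
    · rw [H.ext.map_pull, Y.push_pull, he, ← Y.pull_comp, ← Y.pull_comp, hβ'']

lemma base_change {a b z z' b' : D} {x : a ⟶ b} {y : b ⟶ z} {e : Y.Ext z a} {f : z' ⟶ z}
    {x' : a ⟶ b'} {y' : b' ⟶ z'} (h : Y.IsTriangle x y e) (h' : Y.IsTriangle x' y' (Y.pull f e)) :
    ∃ g : b' ⟶ b, x' ≫ g = x ∧ g ≫ y = y' ≫ f ∧
      Y.IsTriangle (biprod.lift (-y') g) (biprod.desc f y) (Y.push x' e) := by
  obtain ⟨A, B, Z, x₀, y₀, δ, α, β, γ, h₀, hx, hy, he⟩ := H.exists_iso_of_isTriangle h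
  obtain ⟨Z', rfl⟩ := H.frac.obj_surjective z'
  obtain ⟨Z₁, f₀, t, ht, hf₀⟩ := H.frac.exists_right (f ≫ γ.inv)
  have := H.frac.isIso_map ht
  have hf₁ : Q.map f₀ ≫ γ.hom = Q.map t ≫ f := by simp [← hf₀]
  obtain ⟨B₁, x₁, y₁, h₁⟩ := X.exists_isTriangle (X.pull f₀ δ)
  obtain ⟨g₀, hg₀, hg₀', hT⟩ := H.weak.base_change x₀ y₀ δ f₀ x₁ y₁ h₀ h₁
  obtain ⟨β', hβ', hβ''⟩ := H.exists_iso_mid h₁ h' α (asIso (Q.map t)) (by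
    rw [H.ext.map_pull, Y.push_pull, he, ← Y.pull_comp, ← Y.pull_comp, hf₁]
    simp)
  have hy₁ : β'.hom ≫ y' = Q.map y₁ ≫ Q.map t := hβ''
  refine ⟨β'.inv ≫ Q.map g₀ ≫ β.hom, ?_, ?_, ?_⟩
  · rw [← cancel_epi α.hom, ← reassoc_of% hβ', Iso.hom_inv_id_assoc, ← Q.map_comp_assoc, hg₀, hx]
  · rw [Category.assoc, Category.assoc, ← hy, ← Q.map_comp_assoc, hg₀', Q.map_comp, Category.assoc,
      hf₁, Iso.inv_comp_eq, reassoc_of% hy₁]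
  · refine H.isTriangle_of_iso_map hT β' (mapBiprodIso Q (asIso (Q.map t)) β) γ ?_ ?_ ?_
    · ext <;> simp [mapBiprodIso, ← Functor.map_comp_assoc, hy₁]
    · simp only [mapBiprodIso, biprod.lift_desc, map_biprod_desc,
        Preadditive.add_comp, Category.assoc, hf₁, hy, asIso_hom]
    · rw [H.ext.map_push, ← Y.push_comp, hβ', Y.push_comp, he, Y.push_pull]

theorem isWeaklyExtriangulated : Y.IsWeaklyExtriangulated where
  exact_covariant x y e h := (H.isExactSeq h).exact_covariant
  exact_contravariant x y e h := (H.isExactSeq h).exact_contravariant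
  triangle_id_zero a o ho := by
    obtain ⟨A, rfl⟩ := H.frac.obj_surjective a
    obtain ⟨O, hO⟩ := HasZeroObject.zero (C := C)
    refine H.isTriangle_of_iso_map (H.weak.triangle_id_zero A O hO) (Iso.refl _) (Iso.refl _)
      ((Q.map_isZero hO).iso ho) (by simp) (ho.eq_of_tgt _ _) (by simp)
  triangle_zero_id a o ho := by
    obtain ⟨A, rfl⟩ := H.frac.obj_surjective a
    obtain ⟨O, hO⟩ := HasZeroObject.zero (C := C)
    refine H.isTriangle_of_iso_map (H.weak.triangle_zero_id A O hO) ((Q.map_isZero hO).iso ho)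
      (Iso.refl _) (Iso.refl _) ((Q.map_isZero hO).eq_of_src _ _) (by simp) (by simp)
  cobase_change x y e f x' y' h h' := H.cobase_change h h'
  base_change x y e f x' y' h h' := H.base_change h h'

end IsTriangleLocalization

end

/-! ### The universal property -/

section

variable {C : Type u} [Category.{v} C] [Preadditive C] {D : Type u'} [Category.{v'} D]
  [Preadditive D] {Q : C ⥤ D} {W : MorphismProperty C} {N : C → Prop}

/-- Additivity of a functor on `D` can be tested on `C`, since parallel morphisms of `D` are
fractions with a common denominator. -/
lemma IsFractionLocalization.additive_of_comp [Q.Additive] (hQ : IsFractionLocalization Q W N)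
    {E : Type u''} [Category.{v''} E] [Preadditive E] (G : D ⥤ E) [hG : (Q ⋙ G).Additive] :
    G.Additive where
  map_add {a b f g} := by
    obtain ⟨A, rfl⟩ := hQ.obj_surjective a
    obtain ⟨B, rfl⟩ := hQ.obj_surjective b
    obtain ⟨B', f', g', s, hs, hf, hg⟩ := hQ.exists_left₂ f g
    have h : G.map (Q.map (f' + g')) = G.map (Q.map f') + G.map (Q.map g') :=
      hG.map_add (f := f') (g := g')
    rw [Q.map_add, ← hf, ← hg, ← Preadditive.add_comp] at h
    rw [← cancel_mono (G.map (Q.map s)), Preadditive.add_comp]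
    simpa only [← G.map_comp] using h

namespace IsExtLocalization

variable {X : ExtData.{w} C} {Y : ExtData.{w'} D}
  {μ : ∀ Z A : C, X.Ext Z A →+ Y.Ext (Q.obj Z) (Q.obj A)}

lemma exists_rep (hY : IsExtLocalization X Q W Y μ) {z a : D} (e : Y.Ext z a) :
    ∃ (Z A : C) (ζ : Q.obj Z ≅ z) (α : a ≅ Q.obj A) (δ : X.Ext Z A),
      Y.push α.hom (Y.pull ζ.hom e) = μ Z A δ := by
  obtain ⟨A, B, Z, x, y, δ, ζ, α, -, h, -⟩ := hY.exists_isTriangle e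
  exact ⟨Z, A, ζ, α, δ, h⟩

variable {E : Type u''} [Category.{v''} E] [Preadditive E] {T : ExtData.{w''} E} {G : D ⥤ E}

/-- Natural transformations out of the localized bifunctor are determined by their restrictions
along `μ`. -/
lemma hom_ext (hY : IsExtLocalization X Q W Y μ)
    {ψ ψ' : ∀ z a : D, Y.Ext z a →+ T.Ext (G.obj z) (G.obj a)}
    (hpush : ∀ {z a a' : D} (f : a ⟶ a') (e : Y.Ext z a),
      ψ z a' (Y.push f e) = T.push (G.map f) (ψ z a e))
    (hpull : ∀ {z z' a : D} (f : z' ⟶ z) (e : Y.Ext z a),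
      ψ z' a (Y.pull f e) = T.pull (G.map f) (ψ z a e))
    (hpush' : ∀ {z a a' : D} (f : a ⟶ a') (e : Y.Ext z a),
      ψ' z a' (Y.push f e) = T.push (G.map f) (ψ' z a e))
    (hpull' : ∀ {z z' a : D} (f : z' ⟶ z) (e : Y.Ext z a),
      ψ' z' a (Y.pull f e) = T.pull (G.map f) (ψ' z a e))
    (h : ∀ {Z A : C} (δ : X.Ext Z A), ψ _ _ (μ Z A δ) = ψ' _ _ (μ Z A δ)) : ψ = ψ' := by
  funext z a
  ext e
  obtain ⟨Z, A, ζ, α, δ, hδ⟩ := hY.exists_rep e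
  apply T.pull_injective (G.map ζ.hom)
  apply T.push_injective (G.map α.hom)
  rw [← hpull, ← hpush, ← hpull', ← hpush', hδ, h]

/-- The graph of the transformation induced by `φ`: `e ∈ Y(z, a)` and `f ∈ T(G z, G a)` are related
if isomorphisms `Q Z ≅ z` and `a ≅ Q A` transport them to `μ δ` and `φ δ` for one and the same
`δ`. -/
def DescRel (μ : ∀ Z A : C, X.Ext Z A →+ Y.Ext (Q.obj Z) (Q.obj A))
    (φ : ∀ Z A : C, X.Ext Z A →+ T.Ext (G.obj (Q.obj Z)) (G.obj (Q.obj A)))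
    {z a : D} (e : Y.Ext z a) (f : T.Ext (G.obj z) (G.obj a)) : Prop :=
  ∃ (Z A : C) (ζ : Q.obj Z ≅ z) (α : a ≅ Q.obj A) (δ : X.Ext Z A),
    Y.push α.hom (Y.pull ζ.hom e) = μ Z A δ ∧
      T.push (G.map α.hom) (T.pull (G.map ζ.hom) f) = φ Z A δ

variable {φ : ∀ Z A : C, X.Ext Z A →+ T.Ext (G.obj (Q.obj Z)) (G.obj (Q.obj A))}
  (hpush : ∀ {Z A A' : C} (a : A ⟶ A') (δ : X.Ext Z A),
    φ Z A' (X.push a δ) = T.push (G.map (Q.map a)) (φ Z A δ))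
  (hpull : ∀ {Z Z' A : C} (c : Z' ⟶ Z) (δ : X.Ext Z A),
    φ Z' A (X.pull c δ) = T.pull (G.map (Q.map c)) (φ Z A δ))

lemma exists_descRel (hY : IsExtLocalization X Q W Y μ) {z a : D} (e : Y.Ext z a) :
    ∃ f, DescRel (G := G) (T := T) μ φ e f := by
  obtain ⟨Z, A, ζ, α, δ, h⟩ := hY.exists_rep e
  refine ⟨T.push (G.map α.inv) (T.pull (G.map ζ.inv) (φ Z A δ)), Z, A, ζ, α, δ, h, ?_⟩
  rw [← T.push_pull, ← T.push_comp, ← T.pull_comp, ← G.map_comp, ← G.map_comp]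
  simp

lemma DescRel.neg {z a : D} {e : Y.Ext z a} {f : T.Ext (G.obj z) (G.obj a)}
    (h : DescRel μ φ e f) : DescRel μ φ (-e) (-f) := by
  obtain ⟨Z, A, ζ, α, δ, h, h'⟩ := h
  exact ⟨Z, A, ζ, α, -δ, by rw [Y.pull_neg, Y.push_neg, h, map_neg],
    by rw [T.pull_neg, T.push_neg, h', map_neg]⟩

include hpush hpull

lemma DescRel.pushPull (hQ : IsFractionLocalization Q W N) (hY : IsExtLocalization X Q W Y μ)
    {z z' a a' : D} {e : Y.Ext z a} {f : T.Ext (G.obj z) (G.obj a)} (h : DescRel μ φ e f)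
    (c : z' ⟶ z) (k : a ⟶ a') :
    DescRel μ φ (Y.push k (Y.pull c e)) (T.push (G.map k) (T.pull (G.map c) f)) := by
  obtain ⟨Z, A, ζ, α, δ, h, h'⟩ := h
  obtain ⟨Z', rfl⟩ := hQ.obj_surjective z'
  obtain ⟨A', rfl⟩ := hQ.obj_surjective a'
  obtain ⟨A₁, k', s, hs, hk⟩ := hQ.exists_left (α.inv ≫ k)
  obtain ⟨Z₁, c', t, ht, hc⟩ := hQ.exists_right (c ≫ ζ.inv)
  have := hQ.isIso_map hs
  have := hQ.isIso_map ht
  have hk' : k ≫ Q.map s = α.hom ≫ Q.map k' := by simp [← hk]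
  have hc' : Q.map t ≫ c = Q.map c' ≫ ζ.hom := by simp [← hc]
  refine ⟨Z₁, A₁, asIso (Q.map t), asIso (Q.map s), X.push k' (X.pull c' δ), ?_, ?_⟩
  · rw [hY.map_push, hY.map_pull, ← h, asIso_hom, asIso_hom, ← Y.push_pull k, ← Y.push_comp,
      ← Y.pull_comp, hc', hk', Y.push_comp, Y.pull_comp, Y.push_pull α.hom]
  · rw [hpush, hpull, ← h', asIso_hom, asIso_hom, ← T.push_pull (G.map k), ← T.push_comp,
      ← T.pull_comp, ← G.map_comp, ← G.map_comp, hc', hk', G.map_comp, G.map_comp, T.push_comp,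
      T.pull_comp, T.push_pull (G.map α.hom)]

lemma DescRel.add (hQ : IsFractionLocalization Q W N) (hY : IsExtLocalization X Q W Y μ)
    {z a : D} {e e' : Y.Ext z a} {f f' : T.Ext (G.obj z) (G.obj a)} (h : DescRel μ φ e f)
    (h' : DescRel μ φ e' f') : DescRel μ φ (e + e') (f + f') := by
  obtain ⟨Z₁, A₁, ζ₁, α₁, δ₁, h₁, h₁'⟩ := h
  obtain ⟨Z₂, A₂, ζ₂, α₂, δ₂, h₂, h₂'⟩ := h'
  obtain ⟨A₃, g, s, hs, hg⟩ := hQ.exists_left (α₁.inv ≫ α₂.hom)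
  obtain ⟨Z₃, k, t, ht, hk⟩ := hQ.exists_right (ζ₁.hom ≫ ζ₂.inv)
  have := hQ.isIso_map hs
  have := hQ.isIso_map ht
  have hg' : α₂.hom ≫ Q.map s = α₁.hom ≫ Q.map g := by simp [← hg]
  have hk' : Q.map t ≫ ζ₁.hom = Q.map k ≫ ζ₂.hom := by simp [← hk]
  refine ⟨Z₃, A₃, asIso (Q.map t) ≪≫ ζ₁, α₂ ≪≫ asIso (Q.map s),
    X.push g (X.pull t δ₁) + X.push s (X.pull k δ₂), ?_, ?_⟩
  · rw [Y.pull_add, Y.push_add, map_add, hY.map_push, hY.map_pull, hY.map_push, hY.map_pull, ← h₁,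
      ← h₂, ← Y.push_pull α₁.hom, ← Y.push_pull α₂.hom, ← Y.push_comp, ← Y.push_comp,
      ← Y.pull_comp, ← Y.pull_comp]
    simp only [Iso.trans_hom, asIso_hom, hg', hk']
  · rw [T.pull_add, T.push_add, map_add, hpush, hpull, hpush, hpull, ← h₁',
      ← h₂', ← T.push_pull (G.map α₁.hom), ← T.push_pull (G.map α₂.hom), ← T.push_comp,
      ← T.push_comp, ← T.pull_comp, ← T.pull_comp]
    simp only [Iso.trans_hom, asIso_hom, ← G.map_comp, hg', hk']

lemma DescRel.eq_zero (hQ : IsFractionLocalization Q W N) (hY : IsExtLocalization X Q W Y μ)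
    {z a : D} {f : T.Ext (G.obj z) (G.obj a)} (h : DescRel (Y := Y) μ φ 0 f) : f = 0 := by
  obtain ⟨Z, A, ζ, α, δ, h, h'⟩ := h
  obtain ⟨Z', A', t, s, ht, hs, h₀⟩ := hY.exists_eq_zero δ (by
    rw [← h, Y.pull_zero, Y.push_zero])
  have := hQ.isIso_map hs
  have := hQ.isIso_map ht
  apply T.pull_injective (G.map ζ.hom)
  apply T.push_injective (G.map α.hom)
  apply T.pull_injective (G.map (Q.map t))
  apply T.push_injective (G.map (Q.map s))
  rw [h', ← hpull, ← hpush, h₀]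
  simp

/-- A natural transformation from `E` to `T(G Q -, G Q -)` extends to the localized bifunctor. -/
lemma exists_desc (hQ : IsFractionLocalization Q W N) (hY : IsExtLocalization X Q W Y μ) :
    ∃ ψ : ∀ z a : D, Y.Ext z a →+ T.Ext (G.obj z) (G.obj a),
      (∀ {z a a' : D} (f : a ⟶ a') (e : Y.Ext z a),
        ψ z a' (Y.push f e) = T.push (G.map f) (ψ z a e)) ∧
      (∀ {z z' a : D} (f : z' ⟶ z) (e : Y.Ext z a),
        ψ z' a (Y.pull f e) = T.pull (G.map f) (ψ z a e)) ∧
      ∀ {Z A : C} (δ : X.Ext Z A), ψ _ _ (μ Z A δ) = φ Z A δ := by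
  have huniq {z a : D} {e : Y.Ext z a} {f f' : T.Ext (G.obj z) (G.obj a)}
      (h : DescRel μ φ e f) (h' : DescRel μ φ e f') : f = f' := by
    have := DescRel.add hpush hpull hQ hY h h'.neg
    rw [add_neg_cancel] at this
    exact add_neg_eq_zero.1 (DescRel.eq_zero hpush hpull hQ hY this)
  choose ψ hψ using fun {z a : D} (e : Y.Ext z a) =>
    exists_descRel (G := G) (T := T) (φ := φ) hY e
  refine ⟨fun z a => AddMonoidHom.mk' ψ fun e e' =>
      huniq (hψ _) (DescRel.add hpush hpull hQ hY (hψ e) (hψ e')), fun f e => huniq (hψ _) ?_,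
    fun f e => huniq (hψ _) ?_, fun {Z A} δ => huniq (hψ _) ?_⟩
  · simpa using DescRel.pushPull hpush hpull hQ hY (hψ e) (𝟙 _) f
  · simpa using DescRel.pushPull hpush hpull hQ hY (hψ e) f (𝟙 _)
  · exact ⟨Z, A, Iso.refl _, Iso.refl _, δ, by simp, by simp⟩

end IsExtLocalization

end

section

lemma ExtNatTrans.ext_app {C : Type u} [Category.{v} C] [Preadditive C] {X : ExtData.{w} C}
    {D : Type u'} [Category.{v'} D] [Preadditive D] {T : ExtData.{w'} D}
    {F G : ExtExactFunctor X T} {η η' : ExtNatTrans F G} (h : ∀ A, η.η.app A = η'.η.app A) :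
    η = η' := by
  cases η
  cases η'
  congr 1
  exact NatTrans.ext (funext h)

end

section

variable {C : Type u} [Category.{v} C] [Preadditive C] [HasFiniteBiproducts C]
  {S : MorphismProperty C} [Preadditive S.Localization] [S.Q.Additive]
  {X : ExtData.{w} C} {N : C → Prop} {W : MorphismProperty C}
  {Y : ExtData.{w''} S.Localization}
  {μ : ∀ Z A : C, X.Ext Z A →+ Y.Ext (S.Q.obj Z) (S.Q.obj A)}

namespace IsTriangleLocalization

variable (H : IsTriangleLocalization X S.Q W N Y μ)

/-- The localization functor as an exact functor. -/
def exactFunctor : ExtExactFunctor X Y where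
  F := S.Q
  additive := inferInstance
  φ := μ
  φ_push := H.ext.map_push
  φ_pull := H.ext.map_pull
  map_triangle _ _ _ h := H.isTriangle_map h

variable {D : Type u'} [Category.{v'} D] [Preadditive D] [HasFiniteBiproducts D]
  {T : ExtData.{w'} D}

/-- The strict universal property of `C[S⁻¹]` gives the functor, and `exists_desc` the
transformation. -/
lemma existsUnique_lift (hT : T.IsWeaklyExtriangulated) (F : ExtExactFunctor X T)
    (hF : S.IsInvertedBy F.F) : ∃! F₁ : ExtExactFunctor Y T, H.exactFunctor.comp F₁ = F := by
  obtain ⟨FF, hadd, φ, hpush, hpull, htri⟩ := F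
  obtain ⟨G, rfl⟩ : ∃ G : S.Localization ⥤ D, FF = S.Q ⋙ G :=
    ⟨Localization.Construction.lift FF hF, (Localization.Construction.fac FF hF).symm⟩
  have hG : G.Additive := H.frac.additive_of_comp G
  obtain ⟨ψ, hψ, hψ', hμ⟩ := H.ext.exists_desc (T := T) (G := G) (φ := φ) hpush hpull H.frac
  refine ⟨⟨G, hG, ψ, hψ, hψ', fun {a b z} x y e h => ?_⟩, ?_, ?_⟩
  · obtain ⟨A, B, Z, x₀, y₀, δ, α, β, γ, h₀, hx, hy, he⟩ := H.exists_iso_of_isTriangle h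
    refine hT.isTriangle_of_iso (htri x₀ y₀ δ h₀) (G.mapIso α) (G.mapIso β) (G.mapIso γ) ?_ ?_ ?_
    · simpa only [Functor.mapIso_hom, Functor.comp_map, ← G.map_comp] using congrArg G.map hx
    · simpa only [Functor.mapIso_hom, Functor.comp_map, ← G.map_comp] using congrArg G.map hy
    · rw [Functor.mapIso_hom, Functor.mapIso_hom, ← hψ', ← he, hψ, hμ]
  · have : (fun Z A => (ψ (S.Q.obj Z) (S.Q.obj A)).comp (μ Z A)) = φ := by
      funext Z A
      ext δ
      exact hμ δ
    subst this
    rfl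
  · -- Equality of exact functors: first the underlying functors, then the transformations.
    rintro F₂ hF₂
    obtain ⟨G₂, hG₂, ψ₂, h₂, h₂', ht₂⟩ := F₂
    obtain rfl : G₂ = G :=
      Localization.Construction.uniq G₂ G (congrArg ExtExactFunctor.F hF₂)
    have hφ : (fun Z A => (ψ₂ (S.Q.obj Z) (S.Q.obj A)).comp (μ Z A)) = φ := by
      simp only [ExtExactFunctor.comp, exactFunctor] at hF₂
      injection hF₂ with _ hφ
    obtain rfl : ψ₂ = ψ := H.ext.hom_ext h₂ h₂' hψ hψ' fun {Z A} δ => by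
      rw [hμ, ← hφ]
      rfl
    rfl

omit [HasFiniteBiproducts D] in
lemma existsUnique_whiskerLeft (F₁ G₁ : ExtExactFunctor Y T)
    (η : ExtNatTrans (H.exactFunctor.comp F₁) (H.exactFunctor.comp G₁)) :
    ∃! η₁ : ExtNatTrans F₁ G₁, ExtNatTrans.whiskerLeft H.exactFunctor η₁ = η := by
  let τ : F₁.F ⟶ G₁.F := Localization.Construction.natTransExtension η.η
  have hτ (A : C) : τ.app (S.Q.obj A) = η.η.app A :=
    Localization.Construction.NatTransExtension.app_eq η.η A
  refine ⟨⟨τ, fun {z a} e => ?_⟩, ?_, ?_⟩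
  · obtain ⟨Z, A, ζ, α, δ, h⟩ := H.ext.exists_rep e
    have hη : T.push (τ.app (S.Q.obj A)) (F₁.φ _ _ (μ Z A δ)) =
        T.pull (τ.app (S.Q.obj Z)) (G₁.φ _ _ (μ Z A δ)) := by
      rw [hτ, hτ]
      exact η.comm δ
    apply T.pull_injective (F₁.F.map ζ.hom)
    apply T.push_injective (G₁.F.map α.hom)
    rw [← h, F₁.φ_push, F₁.φ_pull, G₁.φ_push, G₁.φ_pull, ← T.push_comp, τ.naturality α.hom,
      ← T.push_pull, ← T.pull_comp, ← τ.naturality ζ.hom] at hη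
    rw [← T.push_pull (τ.app a), ← T.push_comp, hη, ← T.pull_comp]
  · exact ExtNatTrans.ext_app hτ
  · intro η₁ h₁
    refine ExtNatTrans.ext_app fun a => ?_
    obtain ⟨A, rfl⟩ := H.frac.obj_surjective a
    refine Eq.trans ?_ (hτ A).symm
    rw [← h₁]
    rfl

theorem isUniversal : IsUniversal.{w, v, u, w', v', u', w'', max u v, u} S H.exactFunctor :=
  fun _ _ _ _ _ hT => ⟨H.existsUnique_lift hT, fun F₁ G₁ _ _ => H.existsUnique_whiskerLeft F₁ G₁⟩

end IsTriangleLocalization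

end

/-! ### Closure of inflations and deflations under composition -/

section

variable {C : Type u} [Category.{v} C] [Preadditive C] [HasFiniteBiproducts C]
  {D : Type u'} [Category.{v'} D] [Preadditive D]

namespace IsTriangleLocalization

variable {X : ExtData.{w} C} {Q : C ⥤ D} [Q.Additive] {W : MorphismProperty C} {N : C → Prop}
  {Y : ExtData.{w'} D} {μ : ∀ Z A : C, X.Ext Z A →+ Y.Ext (Q.obj Z) (Q.obj A)}
  (H : IsTriangleLocalization X Q W N Y μ)

include H

lemma isInflation_of_iso {A B : C} {x₀ : A ⟶ B} (h : X.IsInflation x₀) {a b : D} {x : a ⟶ b}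
    (α : Q.obj A ≅ a) (β : Q.obj B ≅ b) (hx : Q.map x₀ ≫ β.hom = α.hom ≫ x) :
    Y.IsInflation x := by
  obtain ⟨Z, y₀, δ, h⟩ := h
  exact ⟨Q.obj Z, β.inv ≫ Q.map y₀, Y.push α.hom (μ Z A δ),
    H.isTriangle_of_iso_map h α β (Iso.refl _) hx (by simp) (by simp)⟩

lemma isDeflation_of_iso {B Z : C} {y₀ : B ⟶ Z} (h : X.IsDeflation y₀) {b z : D} {y : b ⟶ z}
    (β : Q.obj B ≅ b) (γ : Q.obj Z ≅ z) (hy : Q.map y₀ ≫ γ.hom = β.hom ≫ y) :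
    Y.IsDeflation y := by
  obtain ⟨A, x₀, δ, h⟩ := h
  refine ⟨Q.obj A, Q.map x₀ ≫ β.hom, Y.pull γ.inv (μ Z A δ),
    H.isTriangle_of_iso_map h (Iso.refl _) β γ (by simp) hy ?_⟩
  rw [← Y.pull_comp]
  simp

/-- An isomorphism `Q B ≅ Q B₁` between the target of an inflation and the source of another one
is a fraction `(Q w) (Q k)⁻¹` with `w` in `W`; the factor `(Q k)⁻¹` is absorbed into the second
inflation by pushing out along `k`. -/
lemma inflation_comp
    (hcomp : ∀ {A B B' E : C} {x : A ⟶ B} {s : B ⟶ B'} {x' : B' ⟶ E}, X.IsInflation x → W s →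
      X.IsInflation x' → ∃ (A₁ E₁ : C) (x₁ : A₁ ⟶ E₁) (α : Q.obj A ≅ Q.obj A₁)
        (ε : Q.obj E₁ ≅ Q.obj E), X.IsInflation x₁ ∧
        Q.map x ≫ Q.map s ≫ Q.map x' = α.hom ≫ Q.map x₁ ≫ ε.hom)
    {a b d : D} {f : a ⟶ b} {g : b ⟶ d} (hf : Y.IsInflation f) (hg : Y.IsInflation g) :
    Y.IsInflation (f ≫ g) := by
  obtain ⟨_, _, _, hf⟩ := hf
  obtain ⟨_, _, _, hg⟩ := hg
  obtain ⟨A, B, Z, x₀, y₀, δ, α, β, -, h₀, hx₀, -, -⟩ := H.exists_iso_of_isTriangle hf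
  obtain ⟨B₁, D₁, Z₁, x₁, y₁, δ₁, β₁, κ, -, h₁, hx₁, -, -⟩ := H.exists_iso_of_isTriangle hg
  obtain ⟨B₃, k, s, hs, hk⟩ := H.frac.exists_left (β₁.hom ≫ β.inv)
  have := H.frac.isIso_map hs
  have : IsIso (Q.map k) := hk ▸ inferInstance
  obtain ⟨D₃, x₃, y₃, h₃⟩ := X.exists_isTriangle (X.push k δ₁)
  obtain ⟨b₀, hb, hb', -⟩ := H.weak.cobase_change x₁ y₁ δ₁ k x₃ y₃ h₁ h₃
  have : IsIso (Q.map b₀) := (H.isExactSeq_map h₁).isIso_mid (H.isExactSeq_map h₃)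
    (a := Q.map k) (c := 𝟙 _) (by rw [← Q.map_comp, hb, Q.map_comp])
    (by rw [← Q.map_comp, hb', Category.comp_id]) (by simp [H.ext.map_push])
  obtain ⟨A₂, D₂, x₂, α₂, ε, h₂, e⟩ := hcomp ⟨_, _, _, h₀⟩ hs ⟨_, _, _, h₃⟩
  refine H.isInflation_of_iso h₂ (α₂.symm ≪≫ α) (ε ≪≫ (asIso (Q.map b₀)).symm ≪≫ κ) ?_
  have e₁ : Q.map x₁ ≫ Q.map b₀ = Q.map k ≫ Q.map x₃ := by rw [← Q.map_comp, hb, Q.map_comp]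
  have e₂ : f = α.inv ≫ Q.map x₀ ≫ β.hom := by simp [hx₀]
  have e₃ : g = β₁.inv ≫ Q.map x₁ ≫ κ.hom := by simp [hx₁]
  have e₄ : Q.map s = β.hom ≫ β₁.inv ≫ Q.map k := by simp [← hk]
  have e₅ : Q.map x₂ ≫ ε.hom = α₂.inv ≫ Q.map x₀ ≫ Q.map s ≫ Q.map x₃ := by simp [e]
  simp only [Iso.trans_hom, Iso.symm_hom, asIso_inv, reassoc_of% e₅, e₂, e₃, e₄, Category.assoc,
    Iso.hom_inv_id_assoc, ← reassoc_of% e₁, IsIso.hom_inv_id_assoc]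

/-- The dual of `inflation_comp`. -/
lemma deflation_comp
    (hcomp : ∀ {B Z Z' E : C} {y : B ⟶ Z} {s : Z ⟶ Z'} {y' : Z' ⟶ E}, X.IsDeflation y → W s →
      X.IsDeflation y' → ∃ (B₁ E₁ : C) (y₁ : B₁ ⟶ E₁) (β : Q.obj B ≅ Q.obj B₁)
        (ε : Q.obj E₁ ≅ Q.obj E), X.IsDeflation y₁ ∧
        Q.map y ≫ Q.map s ≫ Q.map y' = β.hom ≫ Q.map y₁ ≫ ε.hom)
    {a b d : D} {f : a ⟶ b} {g : b ⟶ d} (hf : Y.IsDeflation f) (hg : Y.IsDeflation g) :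
    Y.IsDeflation (f ≫ g) := by
  obtain ⟨_, _, _, hf⟩ := hf
  obtain ⟨_, _, _, hg⟩ := hg
  obtain ⟨A, B, Z, x₀, y₀, δ, -, β, γ, h₀, -, hy₀, -⟩ := H.exists_iso_of_isTriangle hf
  obtain ⟨A₁, B₁, Z₁, x₁, y₁, δ₁, -, β₁, κ, h₁, -, hy₁, -⟩ := H.exists_iso_of_isTriangle hg
  obtain ⟨B₃, k, t, ht, hk⟩ := H.frac.exists_right (β₁.hom ≫ γ.inv)
  have := H.frac.isIso_map ht
  have : IsIso (Q.map k) := hk ▸ inferInstance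
  obtain ⟨M, x₃, y₃, h₃⟩ := X.exists_isTriangle (X.pull k δ)
  obtain ⟨b₀, hb, hb', -⟩ := H.weak.base_change x₀ y₀ δ k x₃ y₃ h₀ h₃
  have : IsIso (Q.map b₀) := (H.isExactSeq_map h₃).isIso_mid (H.isExactSeq_map h₀)
    (a := 𝟙 _) (c := Q.map k) (by rw [← Q.map_comp, hb, Category.id_comp])
    (by rw [← Q.map_comp, hb', Q.map_comp]) (by simp [H.ext.map_pull])
  obtain ⟨B₂, D₂, y₂, β₂, ε, h₂, e⟩ := hcomp ⟨_, _, _, h₃⟩ ht ⟨_, _, _, h₁⟩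
  refine H.isDeflation_of_iso h₂ (β₂.symm ≪≫ asIso (Q.map b₀) ≪≫ β) (ε ≪≫ κ) ?_
  have e₁ : Q.map b₀ ≫ Q.map y₀ = Q.map y₃ ≫ Q.map k := by rw [← Q.map_comp, hb', Q.map_comp]
  have e₂ : f = β.inv ≫ Q.map y₀ ≫ γ.hom := by simp [hy₀]
  have e₃ : g = β₁.inv ≫ Q.map y₁ ≫ κ.hom := by simp [hy₁]
  have e₄ : Q.map t = Q.map k ≫ γ.hom ≫ β₁.inv := by simp [← hk]
  have e₅ : Q.map y₂ ≫ ε.hom = β₂.inv ≫ Q.map y₃ ≫ Q.map t ≫ Q.map y₁ := by simp [e]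
  simp only [Iso.trans_hom, Iso.symm_hom, asIso_hom, reassoc_of% e₅, e₂, e₃, e₄, Category.assoc,
    Iso.hom_inv_id_assoc, reassoc_of% e₁]

end IsTriangleLocalization

end

section

variable {C : Type u} [Category.{v} C] [Preadditive C] [HasFiniteBiproducts C]
  {X : ExtData.{w} C} {S : MorphismProperty C}

lemma M0.isTriangleLocalization (h0 : M0 S) (hX : X.IsWeaklyExtriangulated) (h2 : MR2 S)
    (h3 : MR3 X S) :
    letI := locPreadditive h0 h2
    ∀ {Y : ExtData.{w'} S.Localization}
      {μ : ∀ Z A : C, X.Ext Z A →+ Y.Ext (S.Q.obj Z) (S.Q.obj A)},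
      IsExtLocalization X S.Q (Slift S) Y μ →
        IsTriangleLocalization X S.Q (Slift S) (NS S) Y μ := by
  let := locPreadditive h0 h2
  intro Y μ hY
  have hQ := isFractionLocalization_Q h0 h2
  refine ⟨hX, hQ, hY, fun h h' hac ha hc => ?_, fun h hN => ?_, fun h hN => ?_⟩
  · obtain ⟨b, hb, h₁, h₂⟩ := h3.exists_mid h h' hac ha hc
    have := hQ.isIso_map hb
    refine ⟨asIso (S.Q.map b), ?_, ?_⟩
    · rw [asIso_hom, ← S.Q.map_comp, ← S.Q.map_comp]
      exact congrArg h0.quotLocalization.map h₁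
    · rw [asIso_hom, ← S.Q.map_comp, ← S.Q.map_comp]
      exact congrArg h0.quotLocalization.map h₂
  · exact hQ.isIso_map (inflation_mem hX h0 h3 h hN)
  · exact hQ.isIso_map (deflation_mem hX h0 h3 h hN)

/-- A composite `x' s x` in the ideal quotient which has the form `v x₁ u` with `u`, `v` in `S̄`
agrees with `x₁` in the localization, up to isomorphisms. -/
lemma M0.exists_iso_of_eq (h0 : M0 S) {A B B' E A₁ E₁ : C} {x : A ⟶ B} {s : B ⟶ B'}
    {x' : B' ⟶ E} {x₁ : A₁ ⟶ E₁} {u : (quotFunctor S).obj A ⟶ (quotFunctor S).obj A₁}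
    {v : (quotFunctor S).obj E₁ ⟶ (quotFunctor S).obj E} (hu : Sbar S u) (hv : Sbar S v)
    (h : (quotFunctor S).map x ≫ (quotFunctor S).map s ≫ (quotFunctor S).map x' =
      u ≫ (quotFunctor S).map x₁ ≫ v) :
    ∃ (α : S.Q.obj A ≅ S.Q.obj A₁) (ε : S.Q.obj E₁ ≅ S.Q.obj E),
      S.Q.map x ≫ S.Q.map s ≫ S.Q.map x' = α.hom ≫ S.Q.map x₁ ≫ ε.hom := by
  have : IsIso (h0.quotLocalization.map u) := h0.quotLocalization_inverts u hu
  have : IsIso (h0.quotLocalization.map v) := h0.quotLocalization_inverts v hv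
  let α := asIso (h0.quotLocalization.map u)
  let ε := asIso (h0.quotLocalization.map v)
  refine ⟨α, ε, ?_⟩
  have := congrArg h0.quotLocalization.map h
  simp only [Functor.map_comp] at this
  exact this

lemma exists_inflation_iso_of_MR4 (h0 : M0 S) (h4 : MR4 X S) {A B B' E : C} {x : A ⟶ B}
    {s : B ⟶ B'} {x' : B' ⟶ E} (hx : X.IsInflation x) (hs : Slift S s) (hx' : X.IsInflation x') :
    ∃ (A₁ E₁ : C) (x₁ : A₁ ⟶ E₁) (α : S.Q.obj A ≅ S.Q.obj A₁) (ε : S.Q.obj E₁ ≅ S.Q.obj E),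
      X.IsInflation x₁ ∧ S.Q.map x ≫ S.Q.map s ≫ S.Q.map x' = α.hom ≫ S.Q.map x₁ ≫ ε.hom := by
  have hid (A : C) : Sbar S (𝟙 ((quotFunctor S).obj A)) := by
    simpa using h0.Slift_id A
  obtain ⟨A₁, E₁, x₁, u, v, h₁, hu, hv, h⟩ := h4.1.comp_mem ((quotFunctor S).map x)
    ((quotFunctor S).map s ≫ (quotFunctor S).map x')
    ⟨A, B, x, 𝟙 _, 𝟙 _, hx, hid _, hid _, by simp⟩
    ⟨B', E, x', (quotFunctor S).map s, 𝟙 _, hx', hs, hid _, by simp⟩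
  obtain ⟨α, ε, e⟩ := h0.exists_iso_of_eq hu hv h
  exact ⟨A₁, E₁, x₁, α, ε, h₁, e⟩

lemma exists_deflation_iso_of_MR4 (h0 : M0 S) (h4 : MR4 X S) {A B B' E : C} {x : A ⟶ B}
    {s : B ⟶ B'} {x' : B' ⟶ E} (hx : X.IsDeflation x) (hs : Slift S s) (hx' : X.IsDeflation x') :
    ∃ (A₁ E₁ : C) (x₁ : A₁ ⟶ E₁) (α : S.Q.obj A ≅ S.Q.obj A₁) (ε : S.Q.obj E₁ ≅ S.Q.obj E),
      X.IsDeflation x₁ ∧ S.Q.map x ≫ S.Q.map s ≫ S.Q.map x' = α.hom ≫ S.Q.map x₁ ≫ ε.hom := by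
  have hid (A : C) : Sbar S (𝟙 ((quotFunctor S).obj A)) := by
    simpa using h0.Slift_id A
  obtain ⟨A₁, E₁, x₁, u, v, h₁, hu, hv, h⟩ := h4.2.comp_mem ((quotFunctor S).map x)
    ((quotFunctor S).map s ≫ (quotFunctor S).map x')
    ⟨A, B, x, 𝟙 _, 𝟙 _, hx, hid _, hid _, by simp⟩
    ⟨B', E, x', (quotFunctor S).map s, 𝟙 _, hx', hs, hid _, by simp⟩
  obtain ⟨α, ε, e⟩ := h0.exists_iso_of_eq hu hv h
  exact ⟨A₁, E₁, x₁, α, ε, h₁, e⟩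

end

end Extri

/-- `S.Q : C ⥤ S.Localization` is the (strict) localization of `C` at `S`. The universal property
is stated for targets of the same size as `C` (which determines the structure up to a unique
isomorphism) and for targets of an arbitrary size. -/
theorem theorem3p4 {C : Type u} [SmallCategory.{u} C] [Preadditive C] [HasFiniteBiproducts C]
    (X : ExtData.{u} C) (hX : X.IsExtriangulated) (S : MorphismProperty C) (h0 : M0 S)
    (h1 : MR1 S) (h2 : MR2 S) (h3 : MR3 X S) :
    ∃ (_ : Preadditive S.Localization) (_ : HasFiniteBiproducts S.Localization)
      (Y : ExtData.{u} S.Localization) (L : ExtExactFunctor X Y),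
      Y.IsWeaklyExtriangulated ∧ L.F = S.Q ∧ S.IsInvertedBy L.F ∧
      IsUniversal.{u, u, u, u, u, u, u, u, u} S L ∧
      IsUniversal.{u, u, u, w', v', u', u, u, u} S L ∧
      (MR4 X S → Y.IsExtriangulated) := by
  have hW := hX.toIsWeaklyExtriangulated
  let := locPreadditive h0 h2
  have := Q_additive h0 h2
  have := hasFiniteBiproducts_of_surjective S.Q (Localization.Construction.objEquiv S).surjective
  obtain ⟨Y, μ, hY⟩ := exists_isExtLocalization hW h0 h2 h3
  have H := h0.isTriangleLocalization hW h2 h3 hY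
  refine ⟨inferInstance, inferInstance, Y, H.exactFunctor, H.isWeaklyExtriangulated, rfl,
    S.Q_inverts, H.isUniversal, H.isUniversal, fun h4 => ⟨H.isWeaklyExtriangulated, ?_, ?_⟩⟩
  · exact fun f g => H.inflation_comp (exists_inflation_iso_of_MR4 h0 h4)
  · exact fun f g => H.deflation_comp (exists_deflation_iso_of_MR4 h0 h4)
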